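/- **Model.** An amoebot structure is a finite non-empty set $S$ of $n$ nodes of the infinite triangular grid that induces a connected subgraph $G_S$; each node of $S$ is occupied by one contracted amoebot, and all amoebots share a common compass orientation and chirality. Amoebots are anonymous identical finite state machines that know in which directions they have neighbors and act in synchronous rounds. In the reconfigurable circuit extension, each edge of $G_S$ is replaced by $k$ external links with common labels, for a constant $k$; each amoebot partitions the ends (pins) of its incident links, and the circuits are the connected components of the graph on all partition sets in which two sets are adjacent if a link joins them. In each round, as a function of its previous state, of the partition sets at which it received a beep in the previous round, and, for randomized algorithms, of a fair coin, each amoebot updates its state, chooses its partition, and beeps on any of its partition sets; a beep is received by all partition sets of the circuit. The number of states does not depend on $n$. A spanning tree of $S$ is a tree $T=(S,E_T)$ whose edges are edges of $G_S$. The structure computes $T$ if every amoebot $u$ terminates and knows whether $\{u,v\}\in E_T$ for each of its neighbors $v$. A skeleton is a (not necessarily simple) cycle of amoebots of $S$ that contains all boundary amoebots, i.e. all amoebots adjacent to an unoccupied node (for $n=1$, the cycle that consists of the single amoebot). It is split at one of its positions into a skeleton path $\pi=(v_0,\dots,v_{m-1})$. It is given if every amoebot knows, for each of its occurrences on the cycle,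 which occurrence of which neighbor is its predecessor and which is its successor, and whether the cycle is split there, i.e. whether it is the occurrence $v_0$. Let $V'=\{v_0,\dots,v_{m-1}\}$ and let $T_\pi$ be the graph on $S$ with the following edges: for each $v\in V'\setminus\{v_0\}$, the edge $\{v_{i-1},v_i\}$, where $v_i$ is the first occurrence of $v$ on $\pi$; and for each $v\in S\setminus V'$, the edge from $v$ to its northern neighbor. **Theorem.** 1. For every constant $K$ there is a deterministic algorithm that, for every amoebot structure $S$ of $n$ amoebots and every given split skeleton of $S$ on which each amoebot occurs at most $K$ times, computes $T_\pi$ within $O(\log n)$ rounds, and $T_\pi$ is a spanning tree of $S$. 2. For every constant $c$ there is a randomized algorithm that is given no skeleton and that, for every amoebot structure $S$ of $n$ amoebots, with probability at least $1-1/n^{c}$ computes within $O(\log^2 n)$ rounds a spanning tree of $S$ that is the tree $T_\pi$ of some skeleton path $\pi$ of $S$. The number $k$ of links depends only on $K$ in the first part and is an absolute constant in the second; the constants in the bounds depend only on $K$ and on $c$, respectively. (For $n=1$, where $\log n=0$, the bounds are to be read as $O(1)$.) -/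

import Mathlib

namespace Amoebot

/-! ### The triangular grid and amoebot structures -/

/-- The six cardinal directions along the axes of the triangular grid, in clockwise order. -/
inductive Direction
  | N | ENE | ESE | S | WSW | WNW
  deriving DecidableEq

instance : Fintype Direction :=
  ⟨{.N, .ENE, .ESE, .S, .WSW, .WNW}, fun d => by cases d <;> decide⟩

/-- The opposite direction. -/
def Direction.opp : Direction → Direction
  | .N => .S
  | .ENE => .WSW
  | .ESE => .WNW
  | .S => .N
  | .WSW => .ENE
  | .WNW => .ESE

/-- Nodes of the infinite triangular grid, in the coordinates of the (non-orthogonal) basis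
formed by the unit steps in the directions `ENE` and `N`. -/
abbrev Node := ℤ × ℤ

/-- The unit step in a given direction; note that `ENE + WNW = N` and `N + ESE = ENE`. -/
def Direction.vec : Direction → Node
  | .N => (0, 1)
  | .ENE => (1, 0)
  | .ESE => (1, -1)
  | .S => (0, -1)
  | .WSW => (-1, 0)
  | .WNW => (-1, 1)

/-- The infinite regular triangular grid graph. -/
def triangularGrid : SimpleGraph Node :=
  SimpleGraph.fromRel fun u v => ∃ d : Direction, v = u + d.vec

/-- The graph induced by an amoebot structure, given by its (finite) set of occupied nodes.
All amoebots are contracted, so amoebots are identified with the nodes that they occupy. -/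
def structureGraph (S : Finset Node) : SimpleGraph S :=
  triangularGrid.induce (fun v => v ∈ S)

/-- The directions in which an amoebot has a neighbor. -/
def neighborDirs (S : Finset Node) (u : S) : Set Direction :=
  {d | u.1 + d.vec ∈ S}

/-- A boundary amoebot is adjacent to an unoccupied node. -/
def IsBoundary (S : Finset Node) (u : S) : Prop :=
  ∃ d : Direction, u.1 + d.vec ∉ S

/-! ### Reconfigurable circuits -/

/-- The pins of an amoebot: `(d, j)` is its pin of the `j`-th external link to its neighbor in
direction `d`. A pin in a direction without a neighbor has no external link. -/
abbrev Pin (k : ℕ) := Direction × Fin k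

/-- A pin configuration of an amoebot, i.e., a partition of its pins: it sends every pin to the
label of the partition set that contains it (pins themselves serve as labels, so that every
partition can be represented). -/
abbrev PinConfig (k : ℕ) := Pin k → Pin k

/-- The pin configuration of the system. Its nodes are the partition sets `(u, Q)`; two of them
are connected iff there is an external link between them, the `j`-th link of `u` in direction `d`
being the `j`-th link of its neighbor in the opposite direction. -/
def circuitGraph {k : ℕ} (S : Finset Node) (conf : S → PinConfig k) : SimpleGraph (S × Pin k) :=
  SimpleGraph.fromRel fun a b =>
    ∃ (d : Direction) (j : Fin k), b.1.1 = a.1.1 + d.vec ∧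
      conf a.1 (d, j) = a.2 ∧ conf b.1 (d.opp, j) = b.2

/-- The partition sets at which amoebot `u` receives a beep, where amoebot `v` activates the
partition sets in `beep v`: those whose circuit (connected component) contains an activated
partition set. -/
def received {k : ℕ} (S : Finset Node) (conf : S → PinConfig k) (beep : S → Set (Pin k))
    (u : S) : Set (Pin k) :=
  {Q | ∃ (v : S) (Q' : Pin k), Q' ∈ beep v ∧ (circuitGraph S conf).Reachable (v, Q') (u, Q)}

/-! ### Algorithms and their executions -/

/-- An amoebot algorithm with `k` external links per bond: a finite state machine that is run by
all (anonymous) amoebots. The initial state is a function of the directions in which there are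
neighbors and of the input. In every round, an amoebot updates its state as a function of its
previous state, the partition sets at which it received a beep, and the outcome of a coin. Its
pin configuration and the partition sets that it activates are part of the new state. Its output
is `none` as long as it has not terminated, and irrevocable afterwards. Deterministic algorithms
are those with `Coin = Unit`. -/
structure Algorithm (k : ℕ) (Coin Input Output : Type) where
  State : Type
  finite : Finite State
  init : Set Direction → Input → State
  step : State → Set (Pin k) → Coin → State
  pins : State → PinConfig k
  beep : State → Set (Pin k)
  output : State → Option Output
  output_step : ∀ s r c o, output s = some o → output (step s r c) = some o

/-- The states of the amoebots of `S` after `t` synchronous rounds, on inputs `x` and with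
coins `ω`. -/
def Algorithm.run {k : ℕ} {Coin Input Output : Type} (A : Algorithm k Coin Input Output)
    (S : Finset Node) (x : S → Input) (ω : ℕ → S → Coin) : ℕ → S → A.State
  | 0 => fun u => A.init (neighborDirs S u) (x u)
  | t + 1 => fun u =>
      A.step (A.run S x ω t u)
        (received S (fun v => A.pins (A.run S x ω t v)) (fun v => A.beep (A.run S x ω t v)) u)
        (ω t u)

/-- The uniform distribution of one fair coin per round and amoebot, all independent. -/
noncomputable def coinMeasure (S : Finset Node) : MeasureTheory.Measure (ℕ × S → Bool) :=
  MeasureTheory.Measure.infinitePi fun _ => (PMF.uniformOfFintype Bool).toMeasure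

/-! ### Spanning trees -/

/-- A spanning tree of the amoebot structure `S`. -/
def IsSpanningTree (S : Finset Node) (T : SimpleGraph S) : Prop :=
  T ≤ structureGraph S ∧ T.IsTree

/-- What amoebot `u` has to know about the graph `T`: the directions of those neighbors `v` for
which `{u, v}` is an edge of `T`. -/
def treeDirs {S : Finset Node} (T : SimpleGraph S) (u : S) : Set Direction :=
  {d | ∃ v : S, v.1 = u.1 + d.vec ∧ T.Adj u v}

/-- After `t` rounds, all amoebots have terminated and the amoebot structure has computed `T`. -/
def Algorithm.ComputesTree {k : ℕ} {Coin Input : Type}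
    (A : Algorithm k Coin Input (Set Direction)) {S : Finset Node} (x : S → Input)
    (ω : ℕ → S → Coin) (t : ℕ) (T : SimpleGraph S) : Prop :=
  ∀ u : S, A.output (A.run S x ω t u) = some (treeDirs T u)

/-! ### Skeletons -/

/-- A skeleton of `S`, split at position `0`: a (potentially non-simple) cycle
`node 0, node 1, …, node (len - 1), node 0` of amoebots that contains all boundary amoebots.
If `len = 1`, the cycle consists of a single amoebot and no bonds; `finRotate` is the cyclic
successor on `Fin len`. -/
structure Skeleton (S : Finset Node) where
  len : ℕ
  node : Fin len → S
  bond : ∀ i, finRotate len i ≠ i → (structureGraph S).Adj (node i) (node (finRotate len i))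
  boundary : ∀ u, IsBoundary S u → ∃ i, node i = u

/-- The knowledge of an amoebot about one of its occurrences on a skeleton: its predecessor and its
successor on the cycle (each given by the direction of the neighboring amoebot and the number of
the respective occurrence there), and whether the skeleton is split at this occurrence, i.e.,
whether it is the first one on the skeleton path. -/
structure Occurrence (K : ℕ) where
  pred : Option (Direction × Fin K)
  succ : Option (Direction × Fin K)
  isFirst : Bool

open scoped Classical in
/-- The direction from `u` to a neighbor `v` (`none` if they are not neighbors). -/
noncomputable def dirTo (u v : Node) : Option Direction :=
  if h : ∃ d : Direction, v = u + d.vec then some h.choose else none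

open scoped Classical in
/-- The knowledge of amoebot `u` about a skeleton, where `slot` numbers the occurrences of each
amoebot with numbers from `Fin K`: for each number, the knowledge about the occurrence with this
number, if there is one. -/
noncomputable def Skeleton.view {S : Finset Node} {K : ℕ} (σ : Skeleton S)
    (slot : Fin σ.len → Fin K) (u : S) (a : Fin K) : Option (Occurrence K) :=
  if h : ∃ i, σ.node i = u ∧ slot i = a then
    let i := h.choose
    let p := (finRotate σ.len).symm i
    let s := finRotate σ.len i
    some
      { pred := (dirTo u.1 (σ.node p).1).map fun d => (d, slot p)
        succ := (dirTo u.1 (σ.node s).1).map fun d => (d, slot s)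
        isFirst := decide (i.val = 0) }
  else none

/-- The graph constructed from the skeleton path `node 0, …, node (len - 1)`: for each amoebot on
it other than `node 0`, the edge of the path that leads to its first occurrence, and for each
amoebot that is not on it, the edge to its northern neighbor. -/
def Skeleton.tree {S : Finset Node} (σ : Skeleton S) : SimpleGraph S :=
  SimpleGraph.fromRel fun u v =>
    (∃ i j : Fin σ.len, i.val + 1 = j.val ∧ σ.node i = u ∧ σ.node j = v ∧
      ∀ l, l < j → σ.node l ≠ v) ∨
    ((∀ i, σ.node i ≠ u) ∧ v.1 = u.1 + Direction.N.vec)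

end Amoebot

namespace Amoebot

/-! ### Elementary facts about the grid -/

/-! Given skeleton. Every amoebot other than the first one of the path has exactly one parent: the
predecessor of its first occurrence or, off the skeleton, its northern neighbor, which exists
because such an amoebot is not on the boundary. The position of the first occurrence, extended to
the remaining amoebots so that it drops northwards, decreases towards parents, so this is a tree
(`Skeleton.isSpanningTree_tree`). To find its parent, an amoebot only has to know which of its at
most `K` occurrences comes first. The primary and secondary circuit technique delivers the positions
bit by bit. In iteration `t` the active occurrences are those at the nonzero multiples of `2 ^ t`;
each of them crosses two parallel wires along the path. A beep fed into one wire at the start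
arrives at position `i` on the wire given by the parity of `i / 2 ^ t`, which is bit `t` of `i`
(`Pasc.bit_hears`). Occurrences with bit one become passive, and each amoebot updates its
comparisons of occurrences, later bits having precedence. A global circuit reports when no
occurrence is active, after about `log len` iterations. One more round of messages tells the
parents.

No input. No skeleton has to be constructed: every spanning tree `T` is the tree of a closed walk in
`T` through all amoebots, since the tree of this walk is a connected spanning subgraph of `T`
(`exists_skeleton_tree_eq`). It remains to compute any spanning tree, by Borůvka's method: each
component of a forest joins along its heaviest outgoing edge. With weights that tell the outgoing
edges apart the result is acyclic (`mergeForest_isAcyclic`), and the minimum component size doubles,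
so `log n + 1` phases suffice.

Finite state machines carry this out by tournaments on the circuits of the components. Candidates
beep their coins and drop out when their coin is 0 but a beep is heard; what a component hears is
the coin sequence of its winner, so neighbors in different components eventually hear something
different (`compare_tournament`). The same scheme applied to edges, with the coins of an edge's
owner as digits and two axis bits at the end, selects the heaviest outgoing edge
(`select_tournament`).

Amoebots cannot count to `log n`, so the length of a stage is random: a stage lasts until every
amoebot has tossed tails at the end of some period of `P + 1` rounds (`Boruvka.exists_stage`). The
longest run of heads among `n` amoebots is of order `log n` with high probability, and a large
constant `P` makes the stage long enough to tell all pairs of amoebots apart. A union bound over all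
possible starting times (`coinMeasure_real_not_good_le`) handles the randomness of the schedule. -/

@[simp] lemma Direction.opp_opp (d : Direction) : d.opp.opp = d := by cases d <;> rfl

lemma Direction.opp_ne (d : Direction) : d.opp ≠ d := by cases d <;> decide

lemma Direction.vec_opp (d : Direction) : d.opp.vec = -d.vec := by cases d <;> rfl

lemma Direction.vec_injective : Function.Injective Direction.vec := by
  intro d e h
  cases d <;> cases e <;> first | rfl | (simp [Direction.vec] at h)

lemma Direction.vec_ne_zero (d : Direction) : d.vec ≠ 0 := by
  cases d <;> simp [Direction.vec]

lemma eq_add_vec_opp {u v : Node} {d : Direction} (h : v = u + d.vec) : u = v + d.opp.vec := by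
  rw [h, Direction.vec_opp]; abel

lemma dir_unique {u v : Node} {d e : Direction} (h : v = u + d.vec) (h' : v = u + e.vec) :
    d = e :=
  Direction.vec_injective (add_left_cancel (h.symm.trans h'))

lemma structureGraph_adj {S : Finset Node} {u v : S} :
    (structureGraph S).Adj u v ↔ ∃ d : Direction, v.1 = u.1 + d.vec := by
  simp only [structureGraph, triangularGrid, SimpleGraph.comap_adj, SimpleGraph.fromRel_adj,
    Function.Embedding.subtype_apply]
  constructor
  · rintro ⟨_, ⟨d, h⟩ | ⟨d, h⟩⟩
    · exact ⟨d, h⟩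
    · exact ⟨d.opp, eq_add_vec_opp h⟩
  · rintro ⟨d, h⟩
    refine ⟨fun e => d.vec_ne_zero ?_, Or.inl ⟨d, h⟩⟩
    rw [← e] at h
    simpa using h.symm

lemma dirTo_eq_some {u v : Node} {d : Direction} : dirTo u v = some d ↔ v = u + d.vec := by
  unfold dirTo
  split_ifs with h
  · rw [Option.some_inj]
    exact ⟨fun e => e ▸ h.choose_spec, fun e => dir_unique h.choose_spec e⟩
  · simp only [false_iff]
    exact fun e => h ⟨d, e⟩

/-! ### Circuits with labelled links -/

section Circuits

variable {Λ : Type} {S : Finset Node}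

/-- The elementary connections between partition sets when the links of a bond are labelled
by `Λ`. -/
def LinkRel (S : Finset Node) (conf : S → Direction × Λ → Direction × Λ)
    (a b : S × (Direction × Λ)) : Prop :=
  ∃ (d : Direction) (l : Λ), b.1.1 = a.1.1 + d.vec ∧
    conf a.1 (d, l) = a.2 ∧ conf b.1 (d.opp, l) = b.2

lemma LinkRel.symm {conf : S → Direction × Λ → Direction × Λ} {a b : S × (Direction × Λ)}
    (h : LinkRel S conf a b) : LinkRel S conf b a := by
  obtain ⟨d, l, h1, h2, h3⟩ := h
  exact ⟨d.opp, l, eq_add_vec_opp h1, h3, by simpa using h2⟩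

/-- The partition sets at which `u` receives a beep. -/
def hears (S : Finset Node) (conf : S → Direction × Λ → Direction × Λ)
    (beep : S → Set (Direction × Λ)) (u : S) : Set (Direction × Λ) :=
  {Q | ∃ (v : S) (Q' : Direction × Λ), Q' ∈ beep v ∧
    Relation.ReflTransGen (LinkRel S conf) (v, Q') (u, Q)}

/-- A beep does not leave a union of circuits. -/
lemma hears_subset {conf : S → Direction × Λ → Direction × Λ} {beep : S → Set (Direction × Λ)}
    (X : S → Set (Direction × Λ)) (hbeep : ∀ v, beep v ⊆ X v)
    (hX : ∀ (v w : S) (d : Direction) (l : Λ), w.1 = v.1 + d.vec →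
      conf v (d, l) ∈ X v → conf w (d.opp, l) ∈ X w) (u : S) :
    hears S conf beep u ⊆ X u := by
  rintro Q ⟨v, Q', hQ', h⟩
  have key : ∀ b, Relation.ReflTransGen (LinkRel S conf) (v, Q') b → b.2 ∈ X b.1 := by
    intro b hb
    induction hb with
    | refl => exact hbeep v hQ'
    | tail _ h ih =>
      obtain ⟨d, l, h1, h2, h3⟩ := h
      exact h3 ▸ hX _ _ d l h1 (h2.symm ▸ ih)
  exact key _ h

lemma mem_hears_of_beep {conf : S → Direction × Λ → Direction × Λ}
    {beep : S → Set (Direction × Λ)} {u : S} {Q : Direction × Λ} (h : Q ∈ beep u) :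
    Q ∈ hears S conf beep u :=
  ⟨u, Q, h, .refl⟩

lemma mem_hears_of_link {conf : S → Direction × Λ → Direction × Λ}
    {beep : S → Set (Direction × Λ)} {u v : S} {d : Direction} {l : Λ} (hv : v.1 = u.1 + d.vec)
    (h : conf u (d, l) ∈ hears S conf beep u) :
    conf v (d.opp, l) ∈ hears S conf beep v := by
  obtain ⟨w, Q, hQ, h⟩ := h
  exact ⟨w, Q, hQ, h.tail ⟨d, l, hv, rfl, rfl⟩⟩

/-- Beeps that are activated on a part of the structure that is given by a set `X` closed under
circuits are not affected by the other beeps. -/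
lemma exists_beep_of_mem_hears {conf : S → Direction × Λ → Direction × Λ}
    {beep : S → Set (Direction × Λ)}
    (X : S → Set (Direction × Λ))
    (hX : ∀ (v w : S) (d : Direction) (l : Λ), w.1 = v.1 + d.vec →
      conf v (d, l) ∈ X v → conf w (d.opp, l) ∈ X w) {u : S} {Q : Direction × Λ}
    (hQ : Q ∈ hears S conf beep u) (hQX : Q ∈ X u) :
    ∃ v, ∃ Q' ∈ beep v, Q' ∈ X v := by
  obtain ⟨v, Q', hQ', h⟩ := hQ
  refine ⟨v, Q', hQ', ?_⟩
  have key : ∀ b, Relation.ReflTransGen (LinkRel S conf) b (u, Q) → b.2 ∈ X b.1 := by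
    intro b hb
    induction hb using Relation.ReflTransGen.head_induction_on with
    | refl => exact hQX
    | head h _ ih =>
      obtain ⟨d, l, h1, h2, h3⟩ := h.symm
      exact h3 ▸ hX _ _ d l h1 (h2.symm ▸ ih)
  exact key _ h

/-- If the pins of the links with label `l` are joined exactly along the edges of a graph `F`, then
a beep on their partition set is received in the connected component of `F`. -/
lemma mem_hears_component {conf : S → Direction × Λ → Direction × Λ}
    {beep : S → Set (Direction × Λ)} {F : SimpleGraph S} {l : Λ}
    (hF : F ≤ structureGraph S)
    (h1 : ∀ (u v : S) (d : Direction), v.1 = u.1 + d.vec →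
      (conf u (d, l) = (.N, l) ↔ F.Adj u v))
    (h2 : ∀ u d l', conf u (d, l') = (.N, l) → l' = l) (u : S) :
    (.N, l) ∈ hears S conf beep u ↔ ∃ v, F.Reachable v u ∧ (.N, l) ∈ beep v := by
  constructor
  · intro h
    obtain ⟨v, Q', hQ', hv, rfl⟩ := exists_beep_of_mem_hears
      (X := fun v => {Q | F.Reachable v u ∧ Q = (.N, l)}) (by
        rintro v w d l' hw ⟨hr, hc⟩
        obtain rfl := h2 _ _ _ hc
        have hadj := (h1 v w d hw).1 hc
        exact ⟨hadj.symm.reachable.trans hr,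
          (h1 w v d.opp (eq_add_vec_opp hw)).2 hadj.symm⟩) h
      ⟨SimpleGraph.Reachable.refl _, rfl⟩
    exact ⟨v, hv, hQ'⟩
  · rintro ⟨v, hr, hb⟩
    rw [SimpleGraph.reachable_iff_reflTransGen] at hr
    induction hr with
    | refl => exact mem_hears_of_beep hb
    | tail _ hadj ih =>
      obtain ⟨d, hd⟩ := structureGraph_adj.1 (hF hadj)
      have := mem_hears_of_link (l := l) hd (((h1 _ _ d hd).2 hadj).symm ▸ ih)
      rwa [(h1 _ _ d.opp (eq_add_vec_opp hd)).2 hadj.symm] at this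

/-- A link whose pins form partition sets of their own connects its two endpoints only. -/
lemma mem_hears_message {conf : S → Direction × Λ → Direction × Λ}
    {beep : S → Set (Direction × Λ)} {l : Λ}
    (h1 : ∀ u d, conf u (d, l) = (d, l))
    (h2 : ∀ u d d' l', conf u (d', l') = (d, l) → l' = l) {u v : S} {d : Direction}
    (hv : v.1 = u.1 + d.vec) :
    (d, l) ∈ hears S conf beep u ↔ (d, l) ∈ beep u ∨ (d.opp, l) ∈ beep v := by
  constructor
  · intro h
    obtain ⟨w, Q', hQ', hw⟩ := exists_beep_of_mem_hears
      (X := fun w => {Q | (w = u ∧ Q = (d, l)) ∨ (w = v ∧ Q = (d.opp, l))}) (by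
        rintro w x e l' hx (⟨rfl, hc⟩ | ⟨rfl, hc⟩)
        · obtain rfl := h2 _ _ _ _ hc
          rw [h1] at hc
          obtain rfl : e = d := congrArg Prod.fst hc
          exact Or.inr ⟨Subtype.ext (hx.trans hv.symm), h1 _ _⟩
        · obtain rfl := h2 _ _ _ _ hc
          rw [h1] at hc
          obtain rfl : e = d.opp := congrArg Prod.fst hc
          refine Or.inl ⟨Subtype.ext (hx.trans (eq_add_vec_opp hv).symm), ?_⟩
          rw [h1, Direction.opp_opp]) h
      (Or.inl ⟨rfl, rfl⟩)
    rcases hw with ⟨rfl, rfl⟩ | ⟨rfl, rfl⟩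
    · exact Or.inl hQ'
    · exact Or.inr hQ'
  · rintro (h | h)
    · exact mem_hears_of_beep h
    · have := mem_hears_of_link (conf := conf) (l := l) (eq_add_vec_opp hv)
        (by rw [h1]; exact mem_hears_of_beep h)
      rwa [h1, Direction.opp_opp] at this

/-- A pin in a direction without a neighbor that is a partition set of its own receives only its
own beeps. -/
lemma mem_hears_message_of_no_neighbor {conf : S → Direction × Λ → Direction × Λ}
    {beep : S → Set (Direction × Λ)} {l : Λ}
    (h1 : ∀ u d, conf u (d, l) = (d, l))
    (h2 : ∀ u d d' l', conf u (d', l') = (d, l) → l' = l) {u : S} {d : Direction}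
    (hv : ∀ v : S, v.1 ≠ u.1 + d.vec) :
    (d, l) ∈ hears S conf beep u ↔ (d, l) ∈ beep u := by
  constructor
  · intro h
    obtain ⟨w, Q', hQ', rfl, rfl⟩ := exists_beep_of_mem_hears
      (X := fun w => {Q | w = u ∧ Q = (d, l)}) (by
        rintro w x e l' hx ⟨rfl, hc⟩
        obtain rfl := h2 _ _ _ _ hc
        rw [h1] at hc
        obtain rfl : e = d := congrArg Prod.fst hc
        exact absurd hx (hv x)) h
      ⟨rfl, rfl⟩
    exact hQ'
  · exact mem_hears_of_beep

end Circuits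

/-! ### Algorithms with labelled links -/

/-- An amoebot algorithm whose links carry labels of a finite type `Λ` instead of numbers. -/
structure Machine (Λ Coin Input Output : Type) where
  State : Type
  finite : Finite State
  init : Set Direction → Input → State
  step : State → Set (Direction × Λ) → Coin → State
  pins : State → Direction × Λ → Direction × Λ
  beep : State → Set (Direction × Λ)
  output : State → Option Output
  output_step : ∀ s r c o, output s = some o → output (step s r c) = some o

namespace Machine

variable {Λ Coin Input Output : Type}

/-- The execution of a machine. -/
def run (M : Machine Λ Coin Input Output) (S : Finset Node) (x : S → Input)
    (ω : ℕ → S → Coin) : ℕ → S → M.State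
  | 0 => fun u => M.init (neighborDirs S u) (x u)
  | t + 1 => fun u =>
      M.step (M.run S x ω t u)
        (hears S (fun v => M.pins (M.run S x ω t v)) (fun v => M.beep (M.run S x ω t v)) u)
        (ω t u)

lemma output_run_mono (M : Machine Λ Coin Input Output) {S : Finset Node} {x : S → Input}
    {ω : ℕ → S → Coin} {u : S} {o : Output} {t t' : ℕ} (htt' : t ≤ t')
    (h : M.output (M.run S x ω t u) = some o) : M.output (M.run S x ω t' u) = some o := by
  induction t', htt' using Nat.le_induction with
  | base => exact h
  | succ t' _ ih => exact M.output_step _ _ _ _ ih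

variable {k : ℕ}

/-- The renaming of pins that belongs to a numbering of the labels. -/
def pinEquiv (e : Λ ≃ Fin k) : Direction × Λ ≃ Pin k := (Equiv.refl _).prodCongr e

/-- The algorithm that belongs to a machine and a numbering of its labels. -/
def toAlgorithm (M : Machine Λ Coin Input Output) (e : Λ ≃ Fin k) :
    Algorithm k Coin Input Output where
  State := M.State
  finite := M.finite
  init := M.init
  step s r c := M.step s (pinEquiv e ⁻¹' r) c
  pins s p := pinEquiv e (M.pins s ((pinEquiv e).symm p))
  beep s := (pinEquiv e).symm ⁻¹' M.beep s
  output := M.output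
  output_step s _ c o h := M.output_step s _ c o h

/-- `circuitGraph` is loopless, whereas `LinkRel` may relate a partition set to itself; such steps
do not change what is reachable. -/
lemma preimage_received {S : Finset Node} (e : Λ ≃ Fin k)
    (conf : S → Direction × Λ → Direction × Λ) (beep : S → Set (Direction × Λ)) (u : S) :
    pinEquiv e ⁻¹' received S (fun v p => pinEquiv e (conf v ((pinEquiv e).symm p)))
      (fun v => (pinEquiv e).symm ⁻¹' beep v) u = hears S conf beep u := by
  set G := circuitGraph S (fun v p => pinEquiv e (conf v ((pinEquiv e).symm p))) with hG
  have hmk : ∀ d l, pinEquiv e (d, l) = (d, e l) := fun _ _ => rfl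
  have hlink : ∀ a b : S × (Direction × Λ), LinkRel S conf a b ↔
      ∃ (d : Direction) (j : Fin k), b.1.1 = a.1.1 + d.vec ∧
        pinEquiv e (conf a.1 ((pinEquiv e).symm (d, j))) = pinEquiv e a.2 ∧
        pinEquiv e (conf b.1 ((pinEquiv e).symm (d.opp, j))) = pinEquiv e b.2 := by
    intro a b
    constructor
    · rintro ⟨d, l, h1, h2, h3⟩
      exact ⟨d, e l, h1, by rw [← hmk, Equiv.symm_apply_apply, h2],
        by rw [← hmk, Equiv.symm_apply_apply, h3]⟩
    · rintro ⟨d, j, h1, h2, h3⟩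
      obtain ⟨l, rfl⟩ := e.surjective j
      rw [← hmk, Equiv.symm_apply_apply, (pinEquiv e).injective.eq_iff] at h2 h3
      exact ⟨d, l, h1, h2, h3⟩
  have hreach : ∀ a b : S × (Direction × Λ), Relation.ReflTransGen (LinkRel S conf) a b ↔
      G.Reachable (a.1, pinEquiv e a.2) (b.1, pinEquiv e b.2) := by
    intro a b
    constructor
    · intro h
      induction h with
      | refl => exact SimpleGraph.Reachable.refl _
      | @tail b c _ h ih =>
        by_cases hbc : b = c
        · exact hbc ▸ ih
        refine ih.trans (SimpleGraph.Adj.reachable ?_)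
        refine (SimpleGraph.fromRel_adj _ _ _).2 ⟨?_, Or.inl ((hlink b c).1 h)⟩
        intro heq
        rw [Prod.mk.injEq] at heq
        exact hbc (Prod.ext heq.1 ((pinEquiv e).injective heq.2))
    · intro h
      rw [SimpleGraph.reachable_iff_reflTransGen] at h
      have key : ∀ y : S × Pin k, Relation.ReflTransGen G.Adj (a.1, pinEquiv e a.2) y →
          Relation.ReflTransGen (LinkRel S conf) a (y.1, (pinEquiv e).symm y.2) := by
        intro y hy
        induction hy with
        | refl => simpa using Relation.ReflTransGen.refl
        | @tail y z _ hyz ih =>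
          refine ih.tail ?_
          rcases ((SimpleGraph.fromRel_adj _ _ _).1 hyz).2 with hyz | hyz
          · exact (hlink _ _).2 (by simpa using hyz)
          · exact ((hlink (z.1, (pinEquiv e).symm z.2) (y.1, (pinEquiv e).symm y.2)).2
              (by simpa using hyz)).symm
      simpa using key _ h
  ext Q
  constructor
  · rintro ⟨v, Q', hQ', h⟩
    exact ⟨v, (pinEquiv e).symm Q', hQ', (hreach _ _).2 (by simpa using h)⟩
  · rintro ⟨v, Q', hQ', h⟩
    exact ⟨v, pinEquiv e Q', by simpa using hQ', (hreach _ _).1 h⟩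

lemma run_toAlgorithm (M : Machine Λ Coin Input Output) (e : Λ ≃ Fin k) (S : Finset Node)
    (x : S → Input) (ω : ℕ → S → Coin) (t : ℕ) :
    (M.toAlgorithm e).run S x ω t = M.run S x ω t := by
  induction t with
  | zero => rfl
  | succ t ih =>
    funext u
    change M.step ((M.toAlgorithm e).run S x ω t u) (pinEquiv e ⁻¹' received S
      (fun v p => pinEquiv e (M.pins ((M.toAlgorithm e).run S x ω t v) ((pinEquiv e).symm p)))
      (fun v => (pinEquiv e).symm ⁻¹' M.beep ((M.toAlgorithm e).run S x ω t v)) u) (ω t u) = _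
    rw [ih, preimage_received]
    rfl

end Machine

/-! ### Spanning trees of skeletons -/

/-- A graph whose edges join the vertices other than `r` to their parents is a tree. -/
lemma isTree_of_parent {V : Type*} [Finite V] {T : SimpleGraph V} (par : V → V → Prop)
    (rank : V → ℕ) (r : V) (hadj : ∀ u v, T.Adj u v ↔ par u v ∨ par v u)
    (hrank : ∀ u v, par u v → rank v < rank u) (hex : ∀ u, u ≠ r → ∃ v, par u v)
    (hr : ∀ v, ¬ par r v) (huniq : ∀ u v w, par u v → par u w → v = w) : T.IsTree := by
  have hreach : ∀ n u, rank u = n → T.Reachable u r := by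
    intro n
    induction n using Nat.strong_induction_on with
    | _ n ih =>
      intro u hu
      by_cases hur : u = r
      · exact hur ▸ SimpleGraph.Reachable.refl _
      · obtain ⟨v, hv⟩ := hex u hur
        have hadj : T.Adj u v := (hadj u v).2 (Or.inl hv)
        exact hadj.reachable.trans (ih _ (hu ▸ hrank u v hv) v rfl)
  have hconn : T.Connected :=
    { preconnected := fun u v => (hreach _ u rfl).trans (hreach _ v rfl).symm
      nonempty := ⟨r⟩ }
  rw [SimpleGraph.isTree_iff_connected_and_card]
  refine ⟨hconn, le_antisymm ?_ hconn.card_vert_le_card_edgeSet_add_one⟩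
  choose! p hp using hex
  -- Each edge joins some vertex other than `r` to its chosen parent, so there are at most `|V| - 1`
  -- edges, which a connected graph can only attain as a tree.
  have hsurj : Function.Surjective (fun u : {u // u ≠ r} =>
      (⟨s(u.1, p u.1), (hadj _ _).2 (Or.inl (hp u.1 u.2))⟩ : T.edgeSet)) := by
    rintro ⟨e, he⟩
    induction e using Sym2.ind with
    | _ a b =>
      rcases (hadj a b).1 he with h | h
      · have ha : a ≠ r := fun e => hr b (e ▸ h)
        refine ⟨⟨a, ha⟩, Subtype.ext ?_⟩
        simp only [huniq a _ _ (hp a ha) h]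
      · have hb : b ≠ r := fun e => hr a (e ▸ h)
        refine ⟨⟨b, hb⟩, Subtype.ext ?_⟩
        simp only [huniq b _ _ (hp b hb) h, Sym2.eq_swap]
  have h1 : Nat.card T.edgeSet ≤ _ := Nat.card_le_card_of_surjective _ hsurj
  have h2 : Nat.card {u // u ≠ r} + 1 = Nat.card V := by
    classical
    have := Fintype.ofFinite V
    have h3 := Fintype.card_subtype_compl (fun u => u = r)
    rw [Fintype.card_subtype_eq] at h3
    have h4 : 0 < Fintype.card V := Fintype.card_pos_iff.2 ⟨r⟩
    rw [Nat.card_eq_fintype_card, Nat.card_eq_fintype_card]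
    change Fintype.card {u // ¬ u = r} + 1 = _
    omega
  omega

/-- A northernmost amoebot has no neighbor to the north. -/
lemma exists_isBoundary {S : Finset Node} (hS : S.Nonempty) : ∃ u : S, IsBoundary S u := by
  obtain ⟨u, hu, hmax⟩ := S.exists_max_image (fun u => u.2) hS
  refine ⟨⟨u, hu⟩, .N, fun h => ?_⟩
  have := hmax _ h
  simp [Direction.vec] at this

namespace Skeleton

variable {S : Finset Node} (σ : Skeleton S)

/-- `v` is the parent of `u` in the tree of the skeleton. -/
def Par (u v : S) : Prop :=
  (∃ i j : Fin σ.len, i.val + 1 = j.val ∧ σ.node i = v ∧ σ.node j = u ∧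
      ∀ l, l < j → σ.node l ≠ u) ∨
    ((∀ i, σ.node i ≠ u) ∧ v.1 = u.1 + Direction.N.vec)

lemma finRotate_val {n : ℕ} (i : Fin n) :
    (finRotate n i).val = if i.val + 1 = n then 0 else i.val + 1 := by
  cases n with
  | zero => exact i.elim0
  | succ n =>
    rw [finRotate_apply]
    split_ifs with h
    · have : i = Fin.last n := Fin.ext (by simpa using h)
      rw [this]; simp
    · exact Fin.val_add_one_of_lt (Fin.lt_last_iff_ne_last.2 fun e => h (by simp [e]))

lemma adj_of_succ {i j : Fin σ.len} (h : i.val + 1 = j.val) :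
    (structureGraph S).Adj (σ.node i) (σ.node j) := by
  have hj : finRotate σ.len i = j := by
    apply Fin.ext
    rw [finRotate_val, if_neg (by omega), h]
  have := σ.bond i (by rw [hj]; intro e; rw [e] at h; omega)
  rwa [hj] at this

lemma Par.adj {σ : Skeleton S} {u v : S} (h : σ.Par u v) : (structureGraph S).Adj u v := by
  rcases h with ⟨i, j, hij, rfl, rfl, _⟩ | ⟨_, h⟩
  · exact (σ.adj_of_succ hij).symm
  · exact structureGraph_adj.2 ⟨_, h⟩

lemma tree_adj (u v : S) : σ.tree.Adj u v ↔ σ.Par u v ∨ σ.Par v u := by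
  unfold tree Par
  rw [SimpleGraph.fromRel_adj]
  constructor
  · rintro ⟨_, (⟨i, j, h⟩ | h) | (⟨i, j, h⟩ | h)⟩
    · exact Or.inr (Or.inl ⟨i, j, h⟩)
    · exact Or.inl (Or.inr h)
    · exact Or.inl (Or.inl ⟨i, j, h⟩)
    · exact Or.inr (Or.inr h)
  · intro h
    refine ⟨?_, ?_⟩
    · rcases h with h | h
      · exact (Par.adj (σ := σ) h).ne
      · exact (Par.adj (σ := σ) h).ne.symm
    · rcases h with (⟨i, j, h⟩ | h) | (⟨i, j, h⟩ | h)
      · exact Or.inr (Or.inl ⟨i, j, h⟩)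
      · exact Or.inl (Or.inr h)
      · exact Or.inl (Or.inl ⟨i, j, h⟩)
      · exact Or.inr (Or.inr h)

lemma len_pos (hS : S.Nonempty) : 0 < σ.len := by
  obtain ⟨u, hu⟩ := exists_isBoundary hS
  obtain ⟨i, _⟩ := σ.boundary u hu
  exact i.pos

lemma exists_first {u : S} (h : ∃ i, σ.node i = u) :
    ∃ j, σ.node j = u ∧ ∀ l, l < j → σ.node l ≠ u := by
  obtain ⟨j, hj, hmin⟩ := WellFounded.has_min (wellFounded_lt (α := Fin σ.len))
    {i | σ.node i = u} h
  exact ⟨j, hj, fun l hl e => hmin l e hl⟩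

lemma Par.unique {σ : Skeleton S} {u v w : S} (hv : σ.Par u v) (hw : σ.Par u w) : v = w := by
  rcases hv with ⟨i, j, hij, rfl, rfl, hf⟩ | ⟨hn, hv⟩
  · rcases hw with ⟨i', j', hij', rfl, hj', hf'⟩ | ⟨hn, _⟩
    · have : j = j' := le_antisymm (not_lt.1 fun h => hf _ h hj') (not_lt.1 fun h => hf' _ h rfl)
      have : i = i' := Fin.ext (by omega)
      rw [this]
    · exact absurd rfl (hn j)
  · rcases hw with ⟨i', j', hij', rfl, hj', hf'⟩ | ⟨_, hw⟩
    · exact absurd hj' (hn j')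
    · exact Subtype.ext (hv.trans hw.symm)

/-- The rank of an amoebot on the path is its first position. Off the path it is `len` plus the
remaining height up to the top of the structure, which drops with each step north and exceeds all
ranks on the path. -/
lemma isSpanningTree_tree (hS : S.Nonempty) : IsSpanningTree S σ.tree := by
  classical
  refine ⟨fun u v h => ?_, ?_⟩
  · rcases (σ.tree_adj u v).1 h with h | h
    · exact Par.adj h
    · exact (Par.adj h).symm
  obtain ⟨top, _, htop⟩ := S.exists_max_image (fun u => u.2) hS
  let rank : S → ℕ := fun u =>
    if h : ∃ i, σ.node i = u then (σ.exists_first h).choose.val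
    else σ.len + (top.2 - u.1.2).toNat
  have hrank : ∀ j, (∀ l, l < j → σ.node l ≠ σ.node j) → rank (σ.node j) = j.val := by
    intro j hj
    have h : ∃ i, σ.node i = σ.node j := ⟨j, rfl⟩
    simp only [rank, dif_pos h]
    obtain ⟨h1, h2⟩ := (σ.exists_first h).choose_spec
    exact congrArg Fin.val
      (le_antisymm (not_lt.1 fun hl => h2 _ hl rfl) (not_lt.1 fun hl => hj _ hl h1))
  have hrank' : ∀ i, rank (σ.node i) ≤ i.val := by
    intro i
    have h : ∃ i', σ.node i' = σ.node i := ⟨i, rfl⟩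
    simp only [rank, dif_pos h]
    exact not_lt.1 fun hl => (σ.exists_first h).choose_spec.2 i hl rfl
  have hlen := σ.len_pos hS
  refine isTree_of_parent σ.Par rank (σ.node ⟨0, hlen⟩) σ.tree_adj ?_ ?_ ?_
    (fun u v w => Par.unique)
  · rintro u v (⟨i, j, hij, rfl, rfl, hf⟩ | ⟨hn, hv⟩)
    · rw [hrank j hf]
      exact lt_of_le_of_lt (hrank' i) (by omega)
    · have hu : ¬ ∃ i, σ.node i = u := fun ⟨i, hi⟩ => hn i hi
      by_cases hv' : ∃ i, σ.node i = v
      · obtain ⟨i, rfl⟩ := hv'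
        refine lt_of_le_of_lt (hrank' i) ?_
        simp only [rank, dif_neg hu]
        omega
      · simp only [rank, dif_neg hu, dif_neg hv']
        have h1 := htop v.1 v.2
        have h2 : v.1.2 = u.1.2 + 1 := by rw [hv]; simp [Direction.vec]
        omega
  · intro u hu
    by_cases h : ∃ i, σ.node i = u
    · obtain ⟨j, rfl, hf⟩ := σ.exists_first h
      have hj : j.val ≠ 0 := fun e => hu (congrArg σ.node (Fin.ext e))
      exact ⟨σ.node ⟨j.val - 1, by omega⟩, Or.inl ⟨⟨j.val - 1, by omega⟩, j,
        Nat.sub_add_cancel (Nat.pos_of_ne_zero hj), rfl, rfl, hf⟩⟩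
    · push Not at h
      have hb : ¬ IsBoundary S u := fun hb => by
        obtain ⟨i, hi⟩ := σ.boundary u hb
        exact h i hi
      simp only [IsBoundary, not_exists, not_not] at hb
      exact ⟨⟨_, hb .N⟩, Or.inr ⟨h, rfl⟩⟩
  · rintro v (⟨i, j, hij, rfl, hj, hf⟩ | ⟨hn, _⟩)
    · exact hf ⟨0, hlen⟩ (Fin.lt_def.2 (by simp only; omega)) rfl
    · exact hn _ rfl

end Skeleton

/-- A finite connected graph has a closed walk that visits all vertices. -/
lemma exists_covering_walk {V : Type*} [Finite V] {T : SimpleGraph V} (hT : T.Connected) (r : V) :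
    ∃ w : T.Walk r r, ∀ v, v ∈ w.support := by
  classical
  have := Fintype.ofFinite V
  suffices h : ∀ A : Finset V, ∃ w : T.Walk r r, ∀ v ∈ A, v ∈ w.support by
    obtain ⟨w, hw⟩ := h Finset.univ
    exact ⟨w, fun v => hw v (Finset.mem_univ v)⟩
  intro A
  induction A using Finset.induction_on with
  | empty => exact ⟨.nil, by simp⟩
  | insert a A _ ih =>
    obtain ⟨w, hw⟩ := ih
    obtain ⟨p⟩ := hT.preconnected r a
    refine ⟨w.append (p.append p.reverse), fun v hv => ?_⟩
    rw [SimpleGraph.Walk.mem_support_append_iff, SimpleGraph.Walk.mem_support_append_iff]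
    rcases Finset.mem_insert.1 hv with rfl | hv
    · exact Or.inr (Or.inl p.end_mem_support)
    · exact Or.inl (hw v hv)

/-- Every spanning tree is the tree of a skeleton that walks around it. -/
lemma exists_skeleton_tree_eq {S : Finset Node} {T : SimpleGraph S} (hT : IsSpanningTree S T) :
    ∃ σ : Skeleton S, σ.tree = T := by
  obtain ⟨hle, htree⟩ := hT
  have hconn := htree.1
  obtain ⟨r⟩ := hconn.nonempty
  obtain ⟨w, hw⟩ := exists_covering_walk hconn r
  -- The covering walk may have length 0, if there is only one amoebot; the skeleton then still has
  -- one position.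
  have hpos : 0 < max w.length 1 := by omega
  have hstep : ∀ i : Fin (max w.length 1), finRotate _ i ≠ i →
      T.Adj (w.getVert i.val) (w.getVert (finRotate _ i).val) := by
    intro i hi
    rw [Skeleton.finRotate_val]
    split_ifs with h
    · by_cases h0 : w.length = 0
      · exfalso
        apply hi
        apply Fin.ext
        have := i.2
        rw [Skeleton.finRotate_val]
        rw [if_pos h]; omega
      · have h1 : i.val + 1 = w.length := by omega
        have := w.adj_getVert_succ (i := i.val) (by omega)
        rw [h1, w.getVert_length] at this
        simpa using this
    · exact w.adj_getVert_succ (by have := i.2; omega)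
  let σ : Skeleton S :=
    { len := max w.length 1
      node := fun i => w.getVert i.val
      bond := fun i hi => hle (hstep i hi)
      boundary := by
        intro u _
        obtain ⟨i, hi, hi'⟩ := SimpleGraph.Walk.mem_support_iff_exists_getVert.1 (hw u)
        by_cases h : i < max w.length 1
        · exact ⟨⟨i, h⟩, hi⟩
        · have : i = w.length := by omega
          refine ⟨⟨0, hpos⟩, ?_⟩
          rw [← hi, this, w.getVert_length, w.getVert_zero] }
  refine ⟨σ, ?_⟩
  have hcover : ∀ u, ∃ i, σ.node i = u := by
    intro u
    obtain ⟨i, hi, hi'⟩ := SimpleGraph.Walk.mem_support_iff_exists_getVert.1 (hw u)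
    by_cases h : i < max w.length 1
    · exact ⟨⟨i, h⟩, hi⟩
    · have : i = w.length := by omega
      refine ⟨⟨0, hpos⟩, ?_⟩
      change w.getVert 0 = u
      rw [← hi, this, w.getVert_length, w.getVert_zero]
  have hpar : ∀ u v, σ.Par u v → T.Adj u v := by
    rintro u v (⟨i, j, hij, rfl, rfl, _⟩ | ⟨h, _⟩)
    · have hj : finRotate σ.len i = j := by
        apply Fin.ext
        rw [Skeleton.finRotate_val, if_neg (by omega), hij]
      have := hstep i (by
        change finRotate σ.len i ≠ i
        rw [hj]; intro e; rw [e] at hij; omega)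
      change T.Adj _ (w.getVert (finRotate σ.len i).val) at this
      rw [hj] at this
      exact this.symm
    · obtain ⟨i, hi⟩ := hcover u
      exact absurd hi (h i)
  have hσ : σ.tree ≤ T := by
    intro u v h
    rcases (σ.tree_adj u v).1 h with h | h
    · exact hpar _ _ h
    · exact (hpar _ _ h).symm
  -- A tree is minimal among connected graphs, so its connected subgraph `σ.tree` is all of it.
  have hmin := SimpleGraph.isTree_iff_minimal_connected.1 htree
  exact le_antisymm hσ (hmin.2 (σ.isSpanningTree_tree ⟨r.1, r.2⟩).2.1 hσ)

/-! ### The primary and secondary circuit algorithm on a skeleton path -/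

instance (K : ℕ) : Finite (Occurrence K) :=
  Finite.of_injective (fun o : Occurrence K => (o.pred, o.succ, o.isFirst)) (by
    rintro ⟨a, b, c⟩ ⟨a', b', c'⟩ h
    simpa using h)

namespace Pasc

/-- The labels of the links: a global circuit, messages that are sent in a given direction, and for
each pair of consecutive occurrences with numbers `a` and `b` a primary and a secondary link in
direction `d`. The last kind of links is not used, its pins name partition sets. -/
inductive Label (K : ℕ)
  | glob
  | msg (d : Direction)
  | link (d : Direction) (a b : Fin K) (c : Bool)
  | name (a : Fin K) (c : Bool)
  deriving Fintype

/-- What an amoebot knows about its occurrences. -/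
abbrev View (K : ℕ) := Fin K → Option (Occurrence K)

/-- The states: `act` tells which occurrences are active, `lt a b` compares the low bits of the
positions of the occurrences `a` and `b`. -/
inductive State (K : ℕ)
  | running (x : View K) (act : Fin K → Bool) (lt : Fin K → Fin K → Bool)
  | announce (p : Option Direction)
  | done (o : Set Direction)

instance (K : ℕ) : Finite (State K) :=
  Finite.of_injective
    (fun s : State K => (match s with
      | .running x act lt => Sum.inl (x, act, lt)
      | .announce p => Sum.inr (Sum.inl p)
      | .done o => Sum.inr (Sum.inr o) :
      (View K × (Fin K → Bool) × (Fin K → Fin K → Bool)) ⊕ (Option Direction ⊕ Set Direction)))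
    (by
      rintro (⟨x, a, l⟩ | p | o) (⟨x', a', l'⟩ | p' | o') h <;> simp_all)

variable {K : ℕ}

/-- The occurrence `a` is followed by the occurrence `b` of the neighbor in direction `d`. -/
def IsOut (x : View K) (d : Direction) (a b : Fin K) : Prop :=
  ∃ o, x a = some o ∧ o.succ = some (d, b)

/-- The occurrence `b` is preceded by the occurrence `a` of the neighbor in direction `d`. -/
def IsIn (x : View K) (d : Direction) (a b : Fin K) : Prop :=
  ∃ o, x b = some o ∧ o.pred = some (d, a)

/-- The skeleton is split at the occurrence `a`. -/
def IsFirst (x : View K) (a : Fin K) : Prop := ∃ o, x a = some o ∧ o.isFirst = true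

/-- According to the comparison of occurrences `lt`, the first one of them has its predecessor on
the path in direction `d`. -/
def IsParentDir (x : View K) (lt : Fin K → Fin K → Bool) (d : Direction) : Prop :=
  ∃ a o, x a = some o ∧ o.isFirst = false ∧ (∃ b, o.pred = some (d, b)) ∧
    ∀ b, b ≠ a → x b ≠ none → lt a b = true

open scoped Classical in
/-- The direction of the parent in the tree. -/
noncomputable def parentDir (x : View K) (lt : Fin K → Fin K → Bool) : Option Direction :=
  if ∀ a, x a = none then some .N
  else if h : ∃ d, IsParentDir x lt d then some h.choose else none

open scoped Classical in
/-- The pin configurations. -/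
noncomputable def pins : State K → Direction × Label K → Direction × Label K
  | _, (_, .glob) => (.N, .glob)
  | _, (e, .msg d) => (e, .msg d)
  -- The pins that lend their names are kept away from the partition sets labelled `(.N, .name a c)`
  -- and `(.ENE, .name a c)`, which thus consist of pins of path links only.
  | _, (_, .name a c) => (.S, .name a c)
  | .running x act _, (e, .link d a b c) =>
      if e = d ∧ IsOut x e a b then (.N, .name a c)
      else if e = d.opp ∧ IsIn x e a b then
        -- The bond that closes the cycle ends in partition sets of its own, so that the beep of the
        -- first occurrence is not fed back into it.
        if IsFirst x b then (.ENE, .name b c) else (.N, .name b (c ^^ act b))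
      else (e, .link d a b c)
  | _, (e, .link d a b c) => (e, .link d a b c)

/-- The activated partition sets. -/
def beep : State K → Set (Direction × Label K)
  | .running x act _ =>
      {Q | (Q = (.N, .glob) ∧ ∃ a, act a = true) ∨ ∃ a, Q = (.N, .name a false) ∧ IsFirst x a}
  | .announce p => {Q | ∃ d, p = some d ∧ Q = (d, .msg d)}
  | .done _ => ∅

open scoped Classical in
/-- The bit received by the occurrence `a`. -/
noncomputable def bit (r : Set (Direction × Label K)) (a : Fin K) : Bool :=
  decide ((Direction.N, Label.name a true) ∈ r)

lemma bit_eq_true {r : Set (Direction × Label K)} {a : Fin K} :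
    bit r a = true ↔ (Direction.N, Label.name a true) ∈ r := by simp [bit]

open scoped Classical in
/-- The transition function. -/
noncomputable def step : State K → Set (Direction × Label K) → State K
  | .running x act lt, r =>
      if (Direction.N, Label.glob) ∈ r then
        .running x (fun a => act a && !bit r a)
          (fun a b => if bit r a = bit r b then lt a b else bit r b)
      else .announce (parentDir x lt)
  -- A message label names the direction of travel, so the neighbor in direction `d` speaks with the
  -- label `.msg d.opp`.
  | .announce p, r => .done {d | p = some d ∨ (d, .msg d.opp) ∈ r}
  | .done o, _ => .done o

open scoped Classical in
/-- The machine that computes the tree of a skeleton. -/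
noncomputable def machine (K : ℕ) : Machine (Label K) Unit (View K) (Set Direction) where
  State := State K
  finite := inferInstance
  init _ x := .running x (fun a => decide (∃ o, x a = some o ∧ o.isFirst = false))
    (fun _ _ => false)
  step s r _ := step s r
  pins := pins
  beep := beep
  output
    | .done o => some o
    | _ => none
  output_step := by
    rintro (_ | _ | _) r c o h
    · simp at h
    · simp at h
    · simpa [step] using h

/-! ### Correctness of the primary and secondary circuit algorithm -/

section Correctness

variable {S : Finset Node} (σ : Skeleton S) (slot : Fin σ.len → Fin K)

/-- The knowledge about position `i` of the skeleton. -/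
noncomputable def occ (i : Fin σ.len) : Occurrence K where
  pred := (dirTo (σ.node i).1 (σ.node ((finRotate σ.len).symm i)).1).map
    fun d => (d, slot ((finRotate σ.len).symm i))
  succ := (dirTo (σ.node i).1 (σ.node (finRotate σ.len i)).1).map
    fun d => (d, slot (finRotate σ.len i))
  isFirst := decide (i.val = 0)

variable {σ slot}

lemma view_eq_some (hinj : Function.Injective (fun i => (σ.node i, slot i))) {u : S} {a : Fin K}
    {o : Occurrence K} :
    σ.view slot u a = some o ↔ ∃ i, σ.node i = u ∧ slot i = a ∧ o = occ σ slot i := by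
  unfold Skeleton.view
  constructor
  · intro h
    split_ifs at h with hex
    obtain ⟨h1, h2⟩ := hex.choose_spec
    refine ⟨hex.choose, h1, h2, ?_⟩
    rw [← Option.some_inj.1 h]
    simp only [occ, h1]
  · rintro ⟨i, rfl, rfl, rfl⟩
    have hex : ∃ j, σ.node j = σ.node i ∧ slot j = slot i := ⟨i, rfl, rfl⟩
    rw [dif_pos hex]
    have : hex.choose = i :=
      hinj (Prod.ext hex.choose_spec.1 hex.choose_spec.2)
    simp only [this, occ]

lemma view_eq_none (hinj : Function.Injective (fun i => (σ.node i, slot i))) {u : S} {a : Fin K} :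
    σ.view slot u a = none ↔ ∀ i, σ.node i = u → slot i ≠ a := by
  rw [Option.eq_none_iff_forall_ne_some]
  constructor
  · intro h i h1 h2
    exact h _ ((view_eq_some hinj).2 ⟨i, h1, h2, rfl⟩)
  · intro h o ho
    obtain ⟨i, h1, h2, _⟩ := (view_eq_some hinj).1 ho
    exact h i h1 h2

lemma isOut_view (hinj : Function.Injective (fun i => (σ.node i, slot i))) {u : S}
    {d : Direction} {a b : Fin K} :
    IsOut (σ.view slot u) d a b ↔ ∃ i, σ.node i = u ∧ slot i = a ∧
      slot (finRotate σ.len i) = b ∧ (σ.node (finRotate σ.len i)).1 = u.1 + d.vec := by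
  constructor
  · rintro ⟨o, ho, hs⟩
    obtain ⟨i, rfl, rfl, rfl⟩ := (view_eq_some hinj).1 ho
    simp only [occ, Option.map_eq_some_iff, Prod.mk.injEq] at hs
    obtain ⟨d', hd, rfl, h⟩ := hs
    exact ⟨i, rfl, rfl, h, dirTo_eq_some.1 hd⟩
  · rintro ⟨i, rfl, rfl, rfl, h⟩
    refine ⟨_, (view_eq_some hinj).2 ⟨i, rfl, rfl, rfl⟩, ?_⟩
    simp only [occ, dirTo_eq_some.2 h, Option.map_some]

lemma isIn_view (hinj : Function.Injective (fun i => (σ.node i, slot i))) {u : S}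
    {d : Direction} {a b : Fin K} :
    IsIn (σ.view slot u) d a b ↔ ∃ i, σ.node (finRotate σ.len i) = u ∧ slot i = a ∧
      slot (finRotate σ.len i) = b ∧ (σ.node i).1 = u.1 + d.vec := by
  constructor
  · rintro ⟨o, ho, hs⟩
    obtain ⟨i, rfl, rfl, rfl⟩ := (view_eq_some hinj).1 ho
    simp only [occ, Option.map_eq_some_iff, Prod.mk.injEq] at hs
    obtain ⟨d', hd, rfl, h⟩ := hs
    exact ⟨(finRotate σ.len).symm i, by rw [Equiv.apply_symm_apply], h,
      by rw [Equiv.apply_symm_apply], dirTo_eq_some.1 hd⟩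
  · rintro ⟨i, rfl, rfl, rfl, h⟩
    refine ⟨_, (view_eq_some hinj).2 ⟨_, rfl, rfl, rfl⟩, ?_⟩
    simp only [occ, Equiv.symm_apply_apply, dirTo_eq_some.2 h, Option.map_some]

lemma isFirst_view (hinj : Function.Injective (fun i => (σ.node i, slot i))) (i : Fin σ.len) :
    IsFirst (σ.view slot (σ.node i)) (slot i) ↔ i.val = 0 := by
  constructor
  · rintro ⟨o, ho, hf⟩
    obtain ⟨j, h1, h2, rfl⟩ := (view_eq_some hinj).1 ho
    obtain rfl : j = i := hinj (Prod.ext h1 h2)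
    simpa [occ] using hf
  · intro h
    exact ⟨_, (view_eq_some hinj).2 ⟨i, rfl, rfl, rfl⟩, by simpa [occ] using h⟩

/-- Bit `t` of a number. -/
def par (t i : ℕ) : Bool := decide (i / 2 ^ t % 2 = 1)

/-- The quotient by `2 ^ t` increases exactly when a multiple of `2 ^ t` is reached. -/
lemma par_succ (t i : ℕ) : par t (i + 1) = (par t i ^^ decide (2 ^ t ∣ i + 1)) := by
  unfold par
  rw [Nat.succ_div]
  split_ifs with h
  · rcases Nat.mod_two_eq_zero_or_one (i / 2 ^ t) with h' | h' <;> simp [h, h'] <;> omega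
  · simp [h]

variable (σ slot) in
/-- The situation after `t` iterations. -/
structure Inv (t : ℕ) (s : S → State K) (act : S → Fin K → Bool)
    (lt : S → Fin K → Fin K → Bool) : Prop where
  eq : ∀ u, s u = .running (σ.view slot u) (act u) (lt u)
  act_occ : ∀ i : Fin σ.len, act (σ.node i) (slot i) = decide (i.val ≠ 0 ∧ 2 ^ t ∣ i.val)
  act_none : ∀ u a, act u a = true → ∃ i, σ.node i = u ∧ slot i = a
  lt_iff : ∀ i j : Fin σ.len, σ.node i = σ.node j →
    (lt (σ.node i) (slot i) (slot j) = true ↔ i.val % 2 ^ t < j.val % 2 ^ t)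

variable {t : ℕ} {s : S → State K} {act : S → Fin K → Bool} {lt : S → Fin K → Fin K → Bool}

lemma pins_out {u : S} (h : Inv σ slot t s act lt) {d : Direction} {a b : Fin K} (c : Bool)
    (ho : IsOut (σ.view slot u) d a b) : pins (s u) (d, .link d a b c) = (.N, .name a c) := by
  rw [h.eq]
  simp [pins, ho]

lemma pins_in {u : S} (h : Inv σ slot t s act lt) {d : Direction} {a b : Fin K} (c : Bool)
    (ho : IsIn (σ.view slot u) d.opp a b) :
    pins (s u) (d.opp, .link d a b c) =
      open scoped Classical in
      if IsFirst (σ.view slot u) b then (.ENE, .name b c) else (.N, .name b (c ^^ act u b)) := by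
  rw [h.eq]
  simp [pins, ho, Direction.opp_ne]

/-- The active occurrences are exactly the places where bit `t` flips along the path. The first
position is excluded, as the bit does not continue across the split. -/
lemma par_rotate {i : Fin σ.len} (h : Inv σ slot t s act lt) (h0 : (finRotate σ.len i).val ≠ 0) :
    par t (finRotate σ.len i).val =
      (par t i.val ^^ act (σ.node (finRotate σ.len i)) (slot (finRotate σ.len i))) := by
  rw [h.act_occ]
  rw [Skeleton.finRotate_val] at h0 ⊢
  split_ifs at h0 ⊢ with h'
  · exact absurd rfl h0
  · rw [par_succ]
    simp

variable (σ slot) in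
/-- The partition sets of the circuit that is activated by the first amoebot of the path. -/
def circuit (t : ℕ) (u : S) : Set (Direction × Label K) :=
  {Q | (∃ i, σ.node i = u ∧ Q = (.N, .name (slot i) (par t i.val))) ∨
    ∃ i, (finRotate σ.len i).val = 0 ∧ σ.node (finRotate σ.len i) = u ∧
      Q = (.ENE, .name (slot (finRotate σ.len i)) (par t i.val))}

/-- Both directions of travel along a link are checked. By `par_rotate`, the wire crossing at an
active occurrence matches the flip of the bit, so only the wire given by bit `t` is ever entered. -/
lemma circuit_closed (hinj : Function.Injective (fun i => (σ.node i, slot i)))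
    (h : Inv σ slot t s act lt) (v w : S) (e : Direction) (l : Label K)
    (hw : w.1 = v.1 + e.vec) (hc : pins (s v) (e, l) ∈ circuit σ slot t v) :
    pins (s w) (e.opp, l) ∈ circuit σ slot t w := by
  cases l with
  | glob => simp [circuit, pins] at hc
  | msg d => simp [circuit, pins] at hc
  | name a c => simp [circuit, pins] at hc
  | link d a b c =>
    by_cases h1 : e = d ∧ IsOut (σ.view slot v) e a b
    · obtain ⟨rfl, ho⟩ := h1
      rw [pins_out h c ho] at hc
      obtain ⟨i, rfl, rfl, rfl, hd⟩ := (isOut_view hinj).1 ho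
      have hw' : σ.node (finRotate σ.len i) = w := Subtype.ext (hd.trans hw.symm)
      subst hw'
      have hin : IsIn (σ.view slot (σ.node (finRotate σ.len i))) e.opp (slot i)
          (slot (finRotate σ.len i)) :=
        (isIn_view hinj).2 ⟨i, rfl, rfl, rfl, eq_add_vec_opp hw⟩
      have hcp : c = par t i.val := by
        rcases hc with ⟨j, hj, hQ⟩ | ⟨j, hj, hj', hQ⟩
        · simp only [Prod.mk.injEq, true_and, Label.name.injEq] at hQ
          obtain rfl : i = j := hinj (Prod.ext hj.symm hQ.1)
          exact hQ.2
        · simp at hQ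
      rw [pins_in h c hin]
      split_ifs with hf
      · rw [isFirst_view hinj] at hf
        exact Or.inr ⟨i, hf, rfl, by rw [hcp]⟩
      · rw [isFirst_view hinj] at hf
        exact Or.inl ⟨_, rfl, by rw [hcp, par_rotate h hf]⟩
    · by_cases h2 : e = d.opp ∧ IsIn (σ.view slot v) e a b
      · obtain ⟨rfl, hin⟩ := h2
        rw [pins_in h c hin] at hc
        obtain ⟨i, rfl, rfl, rfl, hd⟩ := (isIn_view hinj).1 hin
        have hw' : σ.node i = w := Subtype.ext (hd.trans hw.symm)
        subst hw'
        have ho : IsOut (σ.view slot (σ.node i)) d (slot i) (slot (finRotate σ.len i)) :=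
          (isOut_view hinj).2 ⟨i, rfl, rfl, rfl, by simpa using eq_add_vec_opp hw⟩
        rw [Direction.opp_opp, pins_out h c ho]
        refine Or.inl ⟨i, rfl, ?_⟩
        split_ifs at hc with hf
        · rcases hc with ⟨j, hj, hQ⟩ | ⟨j, hj, hj', hQ⟩
          · simp at hQ
          · simp only [Prod.mk.injEq, true_and, Label.name.injEq] at hQ
            obtain rfl : i = j :=
              (finRotate σ.len).injective (hinj (Prod.ext hj'.symm hQ.1))
            rw [hQ.2]
        · rw [isFirst_view hinj] at hf
          rcases hc with ⟨j, hj, hQ⟩ | ⟨j, hj, hj', hQ⟩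
          · simp only [Prod.mk.injEq, true_and, Label.name.injEq] at hQ
            obtain rfl : finRotate σ.len i = j := hinj (Prod.ext hj.symm hQ.1)
            rw [par_rotate h hf] at hQ
            rw [Bool.xor_left_inj.1 hQ.2]
          · simp at hQ
      · rw [h.eq] at hc
        simp [pins, h1, h2, circuit] at hc

/-- The beep starts at position 0, whose bits are all zero, and is passed on from each position to
the next one. -/
lemma mem_hears_par (hinj : Function.Injective (fun i => (σ.node i, slot i)))
    (h : Inv σ slot t s act lt) (n : ℕ) : ∀ i : Fin σ.len, i.val = n →
    ((.N, .name (slot i) (par t i.val)) : Direction × Label K) ∈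
      hears S (fun v => pins (s v)) (fun v => beep (s v)) (σ.node i) := by
  induction n with
  | zero =>
    intro i hi
    apply mem_hears_of_beep
    rw [h.eq]
    exact Or.inr ⟨slot i, by simp [par, hi], (isFirst_view hinj i).2 hi⟩
  | succ n ih =>
    intro j hj
    have hi : n < σ.len := by have := j.2; omega
    have hrot : finRotate σ.len ⟨n, hi⟩ = j := by
      apply Fin.ext
      have := j.2
      rw [Skeleton.finRotate_val, if_neg (by simp only; omega), hj]
    have hr := ih ⟨n, hi⟩ rfl
    obtain ⟨d, hd⟩ := structureGraph_adj.1
      (σ.adj_of_succ (i := ⟨n, hi⟩) (j := j) hj.symm)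
    have hout : IsOut (σ.view slot (σ.node ⟨n, hi⟩)) d (slot ⟨n, hi⟩) (slot j) :=
      (isOut_view hinj).2 ⟨_, rfl, rfl, by rw [hrot], by rw [hrot, hd]⟩
    have hin : IsIn (σ.view slot (σ.node j)) d.opp (slot ⟨n, hi⟩) (slot j) :=
      (isIn_view hinj).2 ⟨⟨n, hi⟩, by rw [hrot], rfl, by rw [hrot], eq_add_vec_opp hd⟩
    rw [← pins_out h _ hout] at hr
    have := mem_hears_of_link hd hr
    rw [pins_in h _ hin, if_neg (by rw [isFirst_view hinj]; omega)] at this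
    have hp := par_rotate (i := ⟨n, hi⟩) h (by rw [hrot]; omega)
    rw [hrot] at hp
    rwa [hp]

/-- `mem_hears_par` shows that the right wire is reached; `circuit_closed` shows that the other one
is not. -/
lemma bit_hears (hinj : Function.Injective (fun i => (σ.node i, slot i)))
    (h : Inv σ slot t s act lt) (i : Fin σ.len) :
    bit (hears S (fun v => pins (s v)) (fun v => beep (s v)) (σ.node i)) (slot i) =
      par t i.val := by
  cases hp : par t i.val with
  | true =>
    have := mem_hears_par hinj h _ i rfl
    rw [hp] at this
    exact bit_eq_true.2 this
  | false =>
    rw [← Bool.not_eq_true, bit_eq_true]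
    intro hmem
    by_cases hg : ((.N, .name (slot i) true) : Direction × Label K) ∈ circuit σ slot t (σ.node i)
    · rcases hg with ⟨j, hj, hQ⟩ | ⟨j, hj, hj', hQ⟩
      · simp only [Prod.mk.injEq, true_and, Label.name.injEq] at hQ
        obtain rfl : i = j := hinj (Prod.ext hj.symm hQ.1)
        rw [hp] at hQ
        exact absurd hQ.2 (by decide)
      · simp at hQ
    · refine hg ?_
      have := hears_subset (conf := fun v => pins (s v)) (beep := fun v => beep (s v))
        (X := fun v => circuit σ slot t v ∪ {(.N, .glob)}) (by
          rintro v Q hQ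
          rw [h.eq] at hQ
          rcases hQ with ⟨rfl, _⟩ | ⟨a, rfl, o, ho, hf⟩
          · exact Or.inr rfl
          · obtain ⟨j, rfl, rfl, rfl⟩ := (view_eq_some hinj).1 ho
            refine Or.inl (Or.inl ⟨j, rfl, ?_⟩)
            have : j.val = 0 := by simpa [occ] using hf
            simp [par, this]) (by
          rintro v w e l hw (hc | hc)
          · exact Or.inl (circuit_closed hinj h v w e l hw hc)
          · right
            rw [h.eq] at hc ⊢
            cases l <;> simp [pins] at hc ⊢
            split_ifs at hc <;> simp at hc) (σ.node i) hmem
      rcases this with h | h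
      · exact h
      · simp at h

/-- If any nonzero multiple of `2 ^ t` is a position, then so is `2 ^ t` itself, and its occurrence
is active. -/
lemma glob_hears (hS : (structureGraph S).Connected) (h : Inv σ slot t s act lt) (u : S) :
    ((.N, .glob) : Direction × Label K) ∈
        hears S (fun v => pins (s v)) (fun v => beep (s v)) u ↔ 2 ^ t < σ.len := by
  rw [mem_hears_component (F := structureGraph S) le_rfl]
  · constructor
    · rintro ⟨v, _, hv⟩
      rw [h.eq] at hv
      rcases hv with ⟨_, a, ha⟩ | ⟨a, ha, _⟩
      · obtain ⟨i, rfl, rfl⟩ := h.act_none _ _ ha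
        rw [h.act_occ, decide_eq_true_eq] at ha
        exact lt_of_le_of_lt (Nat.le_of_dvd (Nat.pos_of_ne_zero ha.1) ha.2) i.2
      · simp at ha
    · intro hlt
      refine ⟨σ.node ⟨2 ^ t, hlt⟩, hS.preconnected _ _, ?_⟩
      rw [h.eq]
      refine Or.inl ⟨rfl, slot ⟨2 ^ t, hlt⟩, ?_⟩
      rw [h.act_occ]
      simp
  · intro v w d hw
    simp only [pins, true_iff]
    exact structureGraph_adj.2 ⟨d, hw⟩
  · intro v d l hl
    rw [h.eq] at hl
    cases l <;> simp [pins] at hl ⊢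
    split_ifs at hl <;> simp at hl

/-- A multiple of `2 ^ t` stays active iff its bit `t` is zero, i.e. iff it is a multiple of `2 ^ (t
+ 1)`. -/
lemma inv_step (hinj : Function.Injective (fun i => (σ.node i, slot i)))
    (hS : (structureGraph S).Connected) (h : Inv σ slot t s act lt) (hlt : 2 ^ t < σ.len) :
    ∃ act' lt', Inv σ slot (t + 1)
      (fun u => step (s u) (hears S (fun v => pins (s v)) (fun v => beep (s v)) u)) act' lt' := by
  set r := fun u => hears S (fun v => pins (s v)) (fun v => beep (s v)) u with hr
  refine ⟨fun u a => act u a && !bit (r u) a,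
    fun u a b => if bit (r u) a = bit (r u) b then lt u a b else bit (r u) b, ?_, ?_, ?_, ?_⟩
  · intro u
    change step (s u) (r u) = _
    have := (glob_hears hS h u).2 hlt
    rw [h.eq u]
    simp only [step]
    rw [if_pos this]
  · intro i
    simp only [hr]
    rw [h.act_occ, bit_hears hinj h]
    rw [Bool.eq_iff_iff]
    simp only [ne_eq, Bool.and_eq_true, decide_eq_true_eq, par, Bool.not_eq_true',
      decide_eq_false_iff_not, and_assoc]
    refine and_congr_right fun h0 => ?_
    rw [pow_succ]
    constructor
    · rintro ⟨⟨k, hk⟩, h2⟩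
      rw [hk, Nat.mul_div_cancel_left _ (by positivity)] at h2
      rw [hk]
      exact Nat.mul_dvd_mul_left _ (by omega)
    · intro hd
      refine ⟨dvd_of_mul_right_dvd hd, ?_⟩
      obtain ⟨k, hk⟩ := hd
      rw [hk, mul_assoc, Nat.mul_div_cancel_left _ (by positivity)]
      omega
  · intro u a ha
    simp only [Bool.and_eq_true] at ha
    exact h.act_none u a ha.1
  · intro i j hij
    have hj : bit (r (σ.node i)) (slot j) = par t j.val := by
      rw [hij]; exact bit_hears hinj h j
    have hi : bit (r (σ.node i)) (slot i) = par t i.val := bit_hears hinj h i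
    simp only [hi, hj]
    -- Bit `t` is the leading digit of the residues modulo `2 ^ (t + 1)`: it decides the comparison
    -- unless it agrees.
    rw [Nat.mod_pow_succ, Nat.mod_pow_succ (x := j.val)]
    have hi1 := Nat.mod_lt i.val (show 0 < 2 ^ t by positivity)
    have hj1 := Nat.mod_lt j.val (show 0 < 2 ^ t by positivity)
    have hl := h.lt_iff i j hij
    unfold par
    rcases Nat.mod_two_eq_zero_or_one (i.val / 2 ^ t) with h1 | h1 <;>
    rcases Nat.mod_two_eq_zero_or_one (j.val / 2 ^ t) with h2 | h2 <;>
    simp [h1, h2, hl] <;> omega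

/-- Once `2 ^ t` is at least the length, residues modulo `2 ^ t` are positions, so `lt` orders the
occurrences of an amoebot correctly and reveals the first one. -/
lemma parentDir_eq_some (hinj : Function.Injective (fun i => (σ.node i, slot i)))
    (h : Inv σ slot t s act lt) (hle : σ.len ≤ 2 ^ t) {u v : S} {d : Direction}
    (hv : v.1 = u.1 + d.vec) :
    parentDir (σ.view slot u) (lt u) = some d ↔ σ.Par u v := by
  have hmod : ∀ i : Fin σ.len, i.val % 2 ^ t = i.val := fun i =>
    Nat.mod_eq_of_lt (lt_of_lt_of_le i.2 hle)
  have hdir : ∀ e, IsParentDir (σ.view slot u) (lt u) e ↔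
      ∃ i j : Fin σ.len, i.val + 1 = j.val ∧ (σ.node i).1 = u.1 + e.vec ∧ σ.node j = u ∧
        ∀ l, l < j → σ.node l ≠ u := by
    intro e
    constructor
    · rintro ⟨a, o, ho, hf, ⟨b, hb⟩, hlt⟩
      obtain ⟨j, rfl, rfl, rfl⟩ := (view_eq_some hinj).1 ho
      have hj0 : j.val ≠ 0 := by simpa [occ] using hf
      simp only [occ, Option.map_eq_some_iff, Prod.mk.injEq] at hb
      obtain ⟨d', hd', rfl, -⟩ := hb
      rw [dirTo_eq_some] at hd'
      refine ⟨(finRotate σ.len).symm j, j, ?_, hd', rfl, ?_⟩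
      · have := Skeleton.finRotate_val ((finRotate σ.len).symm j)
        rw [Equiv.apply_symm_apply] at this
        split_ifs at this <;> omega
      · intro l hl hlj
        have hne : slot l ≠ slot j := fun e => hl.ne (hinj (Prod.ext hlj e))
        have h1 := hlt _ hne (by
          rw [ne_eq, view_eq_none hinj]
          exact fun h => h l hlj rfl)
        rw [h.lt_iff j l hlj.symm, hmod, hmod] at h1
        exact absurd (Fin.lt_def.2 h1) hl.asymm
    · rintro ⟨i, j, hij, he, rfl, hf⟩
      have hrot : (finRotate σ.len).symm j = i := by
        rw [Equiv.symm_apply_eq]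
        apply Fin.ext
        rw [Skeleton.finRotate_val, if_neg (by omega), hij]
      refine ⟨slot j, _, (view_eq_some hinj).2 ⟨j, rfl, rfl, rfl⟩, ?_, ?_, ?_⟩
      · simp only [occ, decide_eq_false_iff_not]
        omega
      · refine ⟨slot i, ?_⟩
        simp only [occ, hrot, dirTo_eq_some.2 he, Option.map_some]
      · intro b hb hb'
        rw [ne_eq, view_eq_none hinj] at hb'
        push Not at hb'
        obtain ⟨l, hl, rfl⟩ := hb'
        rw [h.lt_iff j l hl.symm, hmod, hmod]
        exact lt_of_le_of_ne (not_lt.1 fun hlt => hf l (Fin.lt_def.2 hlt) hl)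
          (fun e => hb (by rw [Fin.ext e]))
  unfold parentDir
  split_ifs with h1 h2
  · have hn : ∀ i, σ.node i ≠ u := fun i hi => (view_eq_none hinj).1 (h1 (slot i)) i hi rfl
    rw [Option.some_inj]
    constructor
    · rintro rfl
      exact Or.inr ⟨hn, hv⟩
    · rintro (⟨i, j, _, _, hj, _⟩ | ⟨_, hN⟩)
      · exact absurd hj (hn j)
      · exact dir_unique hN hv
  · have hc := (hdir _).1 h2.choose_spec
    rw [Option.some_inj]
    constructor
    · intro e
      rw [e] at hc
      obtain ⟨i, j, hij, hi, hj⟩ := hc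
      exact Or.inl ⟨i, j, hij, Subtype.ext (hi.trans hv.symm), hj⟩
    · intro hp
      obtain ⟨i, j, hij, hi, hj⟩ := hc
      have := Skeleton.Par.unique hp (Or.inl ⟨i, j, hij, rfl, hj⟩)
      rw [← this] at hi
      exact dir_unique hi hv
  · simp only [false_iff]
    rintro (⟨i, j, hij, rfl, hj⟩ | ⟨hn, _⟩)
    · exact h2 ⟨d, (hdir d).2 ⟨i, j, hij, hv, hj⟩⟩
    · exact h1 fun a => (view_eq_none hinj).2 fun i hi => absurd hi (hn i)

/-- The machine computes the tree of the skeleton. -/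
lemma output_run (hinj : Function.Injective (fun i => (σ.node i, slot i)))
    (hS : (structureGraph S).Connected) (ω : ℕ → S → Unit) (u : S) :
    (machine K).output ((machine K).run S (σ.view slot) ω (Nat.clog 2 σ.len + 2) u) =
      some (treeDirs σ.tree u) := by
  classical
  have hinv : ∀ t, t ≤ Nat.clog 2 σ.len →
      ∃ act lt, Inv σ slot t ((machine K).run S (σ.view slot) ω t) act lt := by
    intro t
    induction t with
    | zero =>
      intro _
      refine ⟨fun u a => decide (∃ o, σ.view slot u a = some o ∧ o.isFirst = false),
        fun _ _ _ => false, fun _ => rfl, ?_, ?_, ?_⟩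
      · intro i
        rw [Bool.eq_iff_iff, decide_eq_true_eq, decide_eq_true_eq]
        constructor
        · rintro ⟨o, ho, hf⟩
          obtain ⟨j, h1, h2, rfl⟩ := (view_eq_some hinj).1 ho
          obtain rfl : j = i := hinj (Prod.ext h1 h2)
          simpa [occ] using hf
        · intro h
          exact ⟨_, (view_eq_some hinj).2 ⟨i, rfl, rfl, rfl⟩, by simpa [occ] using h⟩
      · intro u a ha
        rw [decide_eq_true_eq] at ha
        obtain ⟨o, ho, _⟩ := ha
        obtain ⟨i, h1, h2, _⟩ := (view_eq_some hinj).1 ho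
        exact ⟨i, h1, h2⟩
      · intro i j _
        simp [Nat.mod_one]
    | succ t ih =>
      intro ht
      obtain ⟨act, lt, h⟩ := ih (by omega)
      have hlt : 2 ^ t < σ.len := by
        by_contra hc
        have := Nat.clog_le_of_le_pow (not_lt.1 hc)
        omega
      exact inv_step hinj hS h hlt
  obtain ⟨act, lt, h⟩ := hinv _ le_rfl
  set T := Nat.clog 2 σ.len with hT
  have hle : σ.len ≤ 2 ^ T := Nat.le_pow_clog (by norm_num) _
  have h1 : ∀ v, (machine K).run S (σ.view slot) ω (T + 1) v =
      .announce (parentDir (σ.view slot v) (lt v)) := by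
    intro v
    change step ((machine K).run S (σ.view slot) ω T v) (hears S
      (fun v => pins ((machine K).run S (σ.view slot) ω T v))
      (fun v => beep ((machine K).run S (σ.view slot) ω T v)) v) = _
    have hg := (glob_hears hS h v).not.2 (not_lt.2 hle)
    rw [h.eq v]
    simp only [step]
    rw [if_neg hg]
  have h2 : (machine K).run S (σ.view slot) ω (T + 2) u =
      .done {d | parentDir (σ.view slot u) (lt u) = some d ∨ (d, .msg d.opp) ∈ hears S
        (fun v => pins ((machine K).run S (σ.view slot) ω (T + 1) v))
        (fun v => beep ((machine K).run S (σ.view slot) ω (T + 1) v)) u} := by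
    change step ((machine K).run S (σ.view slot) ω (T + 1) u) _ = _
    rw [h1 u]
    rfl
  rw [h2]
  change some _ = _
  congr 1
  ext d
  have hp1 : ∀ (v : S) (e : Direction), pins ((machine K).run S (σ.view slot) ω (T + 1) v)
      (e, .msg d.opp) = (e, .msg d.opp) := fun v e => by rw [h1 v]; simp [pins]
  have hp2 : ∀ (v : S) (e e' : Direction) (l : Label K),
      pins ((machine K).run S (σ.view slot) ω (T + 1) v) (e', l) = (e, .msg d.opp) →
      l = .msg d.opp := by
    intro v e e' l hl
    rw [h1 v] at hl
    cases l <;> simp_all [pins]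
  have hb : ∀ (v : S) (e : Direction), ((e, .msg d.opp) : Direction × Label K) ∈
      beep ((machine K).run S (σ.view slot) ω (T + 1) v) ↔
      e = d.opp ∧ parentDir (σ.view slot v) (lt v) = some d.opp := by
    intro v e
    rw [h1 v]
    constructor
    · rintro ⟨d', hd', hQ⟩
      simp only [Prod.mk.injEq, Label.msg.injEq] at hQ
      obtain ⟨rfl, rfl⟩ := hQ
      exact ⟨rfl, hd'⟩
    · rintro ⟨rfl, h⟩
      exact ⟨_, h, rfl⟩
  simp only [Set.mem_ofPred_eq, treeDirs]
  by_cases hex : ∃ v : S, v.1 = u.1 + d.vec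
  · obtain ⟨v, hv⟩ := hex
    rw [parentDir_eq_some hinj h hle hv, mem_hears_message hp1 hp2 hv, hb, hb,
      parentDir_eq_some hinj h hle (eq_add_vec_opp hv)]
    constructor
    · intro hor
      refine ⟨v, hv, (σ.tree_adj u v).2 ?_⟩
      rcases hor with h | ⟨h, _⟩ | ⟨_, h⟩
      · exact Or.inl h
      · exact absurd h.symm d.opp_ne
      · exact Or.inr h
    · rintro ⟨v', hv', hadj⟩
      obtain rfl : v' = v := Subtype.ext (hv'.trans hv.symm)
      rcases (σ.tree_adj u v').1 hadj with h | h
      · exact Or.inl h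
      · exact Or.inr (Or.inr ⟨rfl, h⟩)
  · have hex' : ∀ v : S, v.1 ≠ u.1 + d.vec := fun v hv => hex ⟨v, hv⟩
    rw [mem_hears_message_of_no_neighbor hp1 hp2 hex', hb]
    constructor
    · rintro (h' | ⟨h', _⟩)
      · exfalso
        unfold parentDir at h'
        split_ifs at h' with hn hd
        · rw [Option.some_inj] at h'
          subst h'
          have hnb : ¬ IsBoundary S u := fun hbd => by
            obtain ⟨i, hi⟩ := σ.boundary u hbd
            exact (view_eq_none hinj).1 (hn (slot i)) i hi rfl
          simp only [IsBoundary, not_exists, not_not] at hnb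
          exact hex ⟨⟨_, hnb .N⟩, rfl⟩
        · rw [Option.some_inj] at h'
          obtain ⟨a, o, ho, _, ⟨b, hb⟩, _⟩ := hd.choose_spec
          obtain ⟨i, rfl, rfl, rfl⟩ := (view_eq_some hinj).1 ho
          simp only [occ, Option.map_eq_some_iff, Prod.mk.injEq] at hb
          obtain ⟨d', hd', hd'', -⟩ := hb
          rw [dirTo_eq_some, hd'', h'] at hd'
          exact hex ⟨_, hd'⟩
      · exact absurd h'.symm d.opp_ne
    · rintro ⟨v, hv, _⟩
      exact absurd ⟨v, hv⟩ hex

end Correctness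

end Pasc

/-- The tree of a given skeleton is computed deterministically in a logarithmic number of
rounds. -/
theorem exists_algorithm_of_skeleton (K : ℕ) : ∃ (k : ℕ)
    (A : Algorithm k Unit (Fin K → Option (Occurrence K)) (Set Direction)) (C : ℕ),
    ∀ S : Finset Node, (structureGraph S).Connected →
    ∀ (σ : Skeleton S) (slot : Fin σ.len → Fin K),
      Function.Injective (fun i => (σ.node i, slot i)) →
      IsSpanningTree S σ.tree ∧
      A.ComputesTree (σ.view slot) (fun _ _ => ()) (C * (Nat.log 2 S.card + 1)) σ.tree := by
  refine ⟨_, (Pasc.machine K).toAlgorithm (Fintype.equivFin _), K + 3, ?_⟩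
  intro S hS σ slot hinj
  obtain ⟨⟨v, hv⟩⟩ := hS.nonempty
  refine ⟨σ.isSpanningTree_tree ⟨v, hv⟩, fun u => ?_⟩
  rw [Machine.run_toAlgorithm]
  refine Machine.output_run_mono _ ?_ (Pasc.output_run hinj hS _ u)
  -- Occurrences have distinct pairs of node and slot. With `K ≤ 2 ^ K`, this bounds the number of
  -- iterations by `log n + 1 + K`; two more rounds announce the parents, whence the constant `K +
  -- 3`.
  have hlen : σ.len ≤ S.card * K := by
    have := Fintype.card_le_of_injective _ hinj
    simpa using this
  have hle : σ.len ≤ 2 ^ (Nat.log 2 S.card + 1 + K) := by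
    refine hlen.trans ?_
    rw [pow_add]
    exact Nat.mul_le_mul (Nat.lt_pow_succ_log_self (by norm_num) _).le Nat.lt_two_pow_self.le
  have := Nat.clog_le_of_le_pow hle
  nlinarith [Nat.zero_le (Nat.log 2 S.card), Nat.zero_le K]

/-! ### Merging the components of a forest along their heaviest outgoing edges -/

section Boruvka

variable {V : Type*} (H F : SimpleGraph V) (w : V → V → ℕ)

/-- The edges of `H` that leave the connected component of `u` in `F`. -/
def Outgoing (u v : V) : Prop := H.Adj u v ∧ ¬ F.Reachable u v

/-- The outgoing edges that are heaviest for the component of `u`. -/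
def Heaviest (u v : V) : Prop :=
  Outgoing H F u v ∧ ∀ u' v', F.Reachable u u' → Outgoing H F u' v' → w u' v' ≤ w u v

/-- The forest after merging each component along its heaviest outgoing edge. -/
def mergeForest : SimpleGraph V := F ⊔ SimpleGraph.fromRel (Heaviest H F w)

variable {H F w}

lemma Outgoing.symm {u v : V} (h : Outgoing H F u v) : Outgoing H F v u :=
  ⟨h.1.symm, fun hr => h.2 hr.symm⟩

lemma mergeForest_adj {u v : V} : (mergeForest H F w).Adj u v ↔
    F.Adj u v ∨ Heaviest H F w u v ∨ Heaviest H F w v u := by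
  unfold mergeForest
  rw [SimpleGraph.sup_adj, SimpleGraph.fromRel_adj]
  refine or_congr_right ⟨fun h => h.2, fun h => ⟨?_, h⟩⟩
  rcases h with h | h
  · exact h.1.1.ne
  · exact h.1.1.ne.symm

lemma mergeForest_le (hFH : F ≤ H) : mergeForest H F w ≤ H := by
  intro u v h
  rcases mergeForest_adj.1 h with h | h | h
  · exact hFH h
  · exact h.1.1
  · exact h.1.1.symm

/-- Add the selected edges in order of decreasing weight. When the heaviest outgoing edge of a
component is added, no edge added before it leaves this component, as such an edge would be heavier;
so the new edge closes no cycle. -/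
lemma mergeForest_isAcyclic [Finite V] (hF : F.IsAcyclic)
    (hsymm : ∀ u v, Outgoing H F u v → w u v = w v u)
    (hinj : ∀ u v u' v', Outgoing H F u v → Outgoing H F u' v' → w u v = w u' v' →
      (u = u' ∧ v = v') ∨ (u = v' ∧ v = u')) :
    (mergeForest H F w).IsAcyclic := by
  -- `G m` contains the selected edges of weight at least `m`, so `G 0` is the merged forest and `G
  -- m` is `F` for large `m`.
  let G : ℕ → SimpleGraph V := fun m =>
    F ⊔ SimpleGraph.fromRel (fun u v => Heaviest H F w u v ∧ m ≤ w u v)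
  have hG : ∀ m u v, (G m).Adj u v → F.Adj u v ∨ (Outgoing H F u v ∧ m ≤ w u v) := by
    intro m u v h
    simp only [G, SimpleGraph.sup_adj, SimpleGraph.fromRel_adj] at h
    rcases h with h | ⟨_, h | h⟩
    · exact Or.inl h
    · exact Or.inr ⟨h.1.1, h.2⟩
    · exact Or.inr ⟨h.1.1.symm, hsymm _ _ h.1.1 ▸ h.2⟩
  have hstep : ∀ m, (G (m + 1)).IsAcyclic → (G m).IsAcyclic := by
    intro m hm
    by_cases hex : ∃ u v, Heaviest H F w u v ∧ w u v = m
    · obtain ⟨u, v, huv, hw⟩ := hex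
      -- In `G (m + 1)`, the component of `u` has not grown beyond its component in `F`.
      have hreach : ∀ x, (G (m + 1)).Reachable u x → F.Reachable u x := by
        intro x hx
        rw [SimpleGraph.reachable_iff_reflTransGen] at hx
        induction hx with
        | refl => exact SimpleGraph.Reachable.refl _
        | tail _ h ih =>
          rcases hG _ _ _ h with h | ⟨h, hle⟩
          · exact ih.trans h.reachable
          · have := huv.2 _ _ ih h
            omega
      refine (hm.sup_edge_of_not_reachable (fun h => huv.1.2 (hreach _ h))).anti ?_
      intro x y hxy
      simp only [G, SimpleGraph.sup_adj, SimpleGraph.fromRel_adj, SimpleGraph.edge_adj] at hxy ⊢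
      -- By `hinj`, at most one edge has weight `m`, so `G m` exceeds `G (m + 1)` by a single edge.
      have key : ∀ x y, Heaviest H F w x y → m ≤ w x y →
          (m + 1 ≤ w x y) ∨ (u = x ∧ v = y) ∨ (u = y ∧ v = x) := by
        intro x y h1 h2
        rcases h2.lt_or_eq with h | h
        · exact Or.inl h
        · exact Or.inr (hinj _ _ _ _ huv.1 h1.1 (hw.trans h))
      rcases hxy with h | ⟨hne, ⟨h, hle⟩ | ⟨h, hle⟩⟩
      · exact Or.inl (Or.inl h)
      · rcases key _ _ h hle with h' | h' | h'
        · exact Or.inl (Or.inr ⟨hne, Or.inl ⟨h, h'⟩⟩)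
        · exact Or.inr ⟨Or.inl ⟨h'.1.symm, h'.2.symm⟩, hne⟩
        · exact Or.inr ⟨Or.inr ⟨h'.2.symm, h'.1.symm⟩, hne⟩
      · rcases key _ _ h hle with h' | h' | h'
        · exact Or.inl (Or.inr ⟨hne, Or.inr ⟨h, h'⟩⟩)
        · exact Or.inr ⟨Or.inr ⟨h'.2.symm, h'.1.symm⟩, hne⟩
        · exact Or.inr ⟨Or.inl ⟨h'.1.symm, h'.2.symm⟩, hne⟩
    · push Not at hex
      refine hm.anti ?_
      intro x y hxy
      simp only [G, SimpleGraph.sup_adj, SimpleGraph.fromRel_adj] at hxy ⊢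
      refine hxy.imp_right fun h => ⟨h.1, h.2.imp ?_ ?_⟩ <;>
      exact fun h => ⟨h.1, Nat.lt_of_le_of_ne h.2 (hex _ _ h.1).symm⟩
  obtain ⟨M, hM⟩ : ∃ M, ∀ u v, w u v < M := by
    obtain ⟨M, hM⟩ := (Set.finite_range (fun p : V × V => w p.1 p.2)).bddAbove
    exact ⟨M + 1, fun u v => Nat.lt_succ_of_le (hM ⟨(u, v), rfl⟩)⟩
  have htop : (G M).IsAcyclic := by
    refine hF.anti ?_
    intro u v h
    rcases hG _ _ _ h with h | h
    · exact h
    · exact absurd (hM u v) (not_lt.2 h.2)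
  have hall : ∀ k, k ≤ M → (G (M - k)).IsAcyclic := by
    intro k
    induction k with
    | zero => exact fun _ => htop
    | succ k ih =>
      intro hk
      apply hstep
      have : M - (k + 1) + 1 = M - k := by omega
      rw [this]
      exact ih (by omega)
  have h0 := hall M le_rfl
  rw [Nat.sub_self] at h0
  simpa [G, mergeForest] using h0

/-- A walk from `u` to `x` in `H` has to leave the component of `u`. -/
lemma exists_outgoing (hH : H.Connected) {u x : V} (hux : ¬ F.Reachable u x) :
    ∃ u' v', F.Reachable u u' ∧ Outgoing H F u' v' := by
  obtain ⟨p⟩ := hH.preconnected u x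
  obtain ⟨d, _, h1, h2⟩ := p.exists_boundary_dart {v | F.Reachable u v}
    (SimpleGraph.Reachable.refl _) hux
  exact ⟨d.fst, d.snd, h1, d.adj, fun h => h2 (SimpleGraph.Reachable.trans h1 h)⟩

lemma exists_heaviest [Finite V] {u : V} (h : ∃ u' v', F.Reachable u u' ∧ Outgoing H F u' v') :
    ∃ u' v', F.Reachable u u' ∧ Heaviest H F w u' v' := by
  obtain ⟨u₀, v₀, h₀⟩ := h
  obtain ⟨⟨a, b⟩, hab, hmax⟩ := Set.exists_max_image
    {p : V × V | F.Reachable u p.1 ∧ Outgoing H F p.1 p.2} (fun p => w p.1 p.2)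
    (Set.toFinite _) ⟨(u₀, v₀), h₀⟩
  exact ⟨a, b, hab.1, hab.2, fun u' v' h1 h2 => hmax (u', v') ⟨hab.1.trans h1, h2⟩⟩

/-- Unless there is only one component, merging doubles the minimum size of the components. -/
lemma two_mul_le_ncard_mergeForest [Finite V] (hH : H.Connected) {k : ℕ}
    (hk : ∀ u, k ≤ {v | F.Reachable u v}.ncard) (hex : ∃ u v, Outgoing H F u v) (u : V) :
    2 * k ≤ {v | (mergeForest H F w).Reachable u v}.ncard := by
  obtain ⟨a, b, hab⟩ := hex
  have hux : ∃ x, ¬ F.Reachable u x := by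
    by_contra! h
    exact hab.2 ((h a).symm.trans (h b))
  obtain ⟨x, hux⟩ := hux
  obtain ⟨u', v', hr, hh⟩ := exists_heaviest (w := w) (exists_outgoing hH hux)
  have hle : F ≤ mergeForest H F w := le_sup_left
  have hdisj : Disjoint {v | F.Reachable u v} {v | F.Reachable v' v} := by
    rw [Set.disjoint_left]
    intro y h1 h2
    exact hh.1.2 (hr.symm.trans (SimpleGraph.Reachable.trans h1 h2.symm))
  have hsub : {v | F.Reachable u v} ∪ {v | F.Reachable v' v} ⊆
      {v | (mergeForest H F w).Reachable u v} := by
    rintro y (h | h)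
    · exact SimpleGraph.Reachable.mono hle h
    · refine (hr.mono hle).trans (SimpleGraph.Reachable.trans ?_
        (SimpleGraph.Reachable.mono hle h))
      exact SimpleGraph.Adj.reachable (mergeForest_adj.2 (Or.inr (Or.inl hh)))
  have h1 := Set.ncard_le_ncard hsub (Set.toFinite _)
  rw [Set.ncard_union_eq hdisj (Set.toFinite _) (Set.toFinite _)] at h1
  have := hk u
  have := hk v'
  omega

end Boruvka

/-! ### Tournaments on the components of a graph -/

section Tournaments

variable {V : Type*} {F : SimpleGraph V}

/-- In each component, the candidates whose coins are smaller than those of another one drop out.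
Components notice whether they have heard the same coins. -/
lemma compare_tournament {ℓ : ℕ} {coin cand heard : ℕ → V → Bool}
    (hheard : ∀ i < ℓ, ∀ u, heard i u = true ↔
      ∃ v, F.Reachable v u ∧ cand i v = true ∧ coin i v = true)
    (hcand : ∀ i < ℓ, ∀ u, cand (i + 1) u = (cand i u && (coin i u == heard i u)))
    (hcand0 : ∀ u, cand 0 u = true) (u v : V) :
    (F.Reachable u v → ∀ i < ℓ, heard i u = heard i v) ∧
    ((∀ a b, a ≠ b → ∃ i, 1 ≤ i ∧ i < ℓ ∧ coin i a ≠ coin i b) → ¬ F.Reachable u v →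
      ∃ i, 1 ≤ i ∧ i < ℓ ∧ heard i u ≠ heard i v) := by
  have hconst : ∀ u v, F.Reachable u v → ∀ i < ℓ, heard i u = heard i v := by
    intro u v huv i hi
    rw [Bool.eq_iff_iff, hheard i hi, hheard i hi]
    exact ⟨fun ⟨x, h1, h2⟩ => ⟨x, h1.trans huv, h2⟩,
      fun ⟨x, h1, h2⟩ => ⟨x, h1.trans huv.symm, h2⟩⟩
  refine ⟨hconst u v, fun hdiff huv => ?_⟩
  -- Candidates never die out: if a coin is heard, its tosser stays; if none is heard, all
  -- candidates stay.
  have hex : ∀ i ≤ ℓ, ∀ u, ∃ v, F.Reachable v u ∧ cand i v = true := by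
    intro i
    induction i with
    | zero => exact fun _ u => ⟨u, SimpleGraph.Reachable.refl _, hcand0 u⟩
    | succ i ih =>
      intro hi u
      cases hh : heard i u with
      | true =>
        obtain ⟨v, h1, h2, h3⟩ := (hheard i (by omega) u).1 hh
        refine ⟨v, h1, ?_⟩
        rw [hcand i (by omega), h2, h3, hconst v u h1 i (by omega), hh]
        rfl
      | false =>
        obtain ⟨v, h1, h2⟩ := ih (by omega) u
        refine ⟨v, h1, ?_⟩
        have h3 : coin i v = false := by
          rw [← Bool.not_eq_true]
          intro h3
          rw [(hheard i (by omega) u).2 ⟨v, h1, h2, h3⟩] at hh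
          exact absurd hh (by decide)
        rw [hcand i (by omega), h2, h3, hconst v u h1 i (by omega), hh]
        rfl
  -- A surviving candidate has agreed with its component in every round, so what is heard is its own
  -- coin sequence.
  have hwin : ∀ v, ∀ i ≤ ℓ, cand i v = true → ∀ j < i, coin j v = heard j v := by
    intro v i
    induction i with
    | zero => intro _ _ j hj; omega
    | succ i ih =>
      intro hi hc j hj
      rw [hcand i (by omega), Bool.and_eq_true, beq_iff_eq] at hc
      rcases Nat.lt_succ_iff_lt_or_eq.1 hj with hj | rfl
      · exact ih (by omega) hc.1 j hj
      · exact hc.2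
  obtain ⟨a, ha, hca⟩ := hex ℓ le_rfl u
  obtain ⟨b, hb, hcb⟩ := hex ℓ le_rfl v
  obtain ⟨i, hi1, hi, hne⟩ := hdiff a b (fun e => huv (ha.symm.trans (e ▸ hb)))
  refine ⟨i, hi1, hi, fun e => hne ?_⟩
  rw [hwin a ℓ le_rfl hca i hi, hwin b ℓ le_rfl hcb i hi, hconst a u ha i hi, hconst b v hb i hi, e]

/-- The number with given binary digits, the most significant one first. -/
def keyOf (e : ℕ → Bool) : ℕ → ℕ
  | 0 => 0
  | i + 1 => 2 * keyOf e i + (e i).toNat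

lemma eq_of_keyOf_eq {e e' : ℕ → Bool} {n : ℕ} (h : keyOf e n = keyOf e' n) :
    ∀ i < n, e i = e' i := by
  induction n with
  | zero => intro i hi; omega
  | succ n ih =>
    simp only [keyOf] at h
    have h1 := Bool.toNat_le (e n)
    have h2 := Bool.toNat_le (e' n)
    intro i hi
    rcases Nat.lt_succ_iff_lt_or_eq.1 hi with hi | rfl
    · exact ih (by omega) i hi
    · have h3 : (e i).toNat = (e' i).toNat := by omega
      revert h3
      cases e i <;> cases e' i <;> simp

lemma keyOf_congr {e e' : ℕ → Bool} {n : ℕ} (h : ∀ i < n, e i = e' i) :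
    keyOf e n = keyOf e' n := by
  induction n with
  | zero => rfl
  | succ n ih =>
    simp only [keyOf]
    rw [ih fun i hi => h i (by omega), h n (by omega)]

/-- In each component, the outgoing edges whose digits are smaller than those of another one drop
out, which leaves the heaviest ones. -/
lemma select_tournament {H : SimpleGraph V} {ℓ : ℕ} {e surv : ℕ → V → V → Bool}
    {heard : ℕ → V → Bool}
    (hheard : ∀ i < ℓ, ∀ u, heard i u = true ↔
      ∃ v x, F.Reachable v u ∧ surv i v x = true ∧ e i v x = true)
    (hsurv : ∀ i < ℓ, ∀ u x, surv (i + 1) u x = (surv i u x && (e i u x == heard i u)))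
    (hsurv0 : ∀ u x, surv 0 u x = true ↔ Outgoing H F u x) :
    ∀ i ≤ ℓ, ∀ u x, surv i u x = true ↔
      Heaviest H F (fun u x => keyOf (fun j => e j u x) i) u x := by
  intro i
  induction i with
  | zero =>
    intro _ u x
    rw [hsurv0]
    exact ⟨fun h => ⟨h, fun _ _ _ _ => le_rfl⟩, fun h => h.1⟩
  | succ i ih =>
    intro hi u x
    have ih := ih (by omega)
    rw [hsurv i (by omega), Bool.and_eq_true, beq_iff_eq, ih]
    have hle : ∀ u x, (e i u x).toNat ≤ 1 := fun u x => Bool.toNat_le _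
    constructor
    · rintro ⟨⟨hout, hmax⟩, heq⟩
      refine ⟨hout, fun u' x' hr hout' => ?_⟩
      have h1 := hmax u' x' hr hout'
      have h2 := hle u' x'
      simp only [keyOf]
      beta_reduce at h1
      -- A strictly smaller prefix stays behind whatever digits follow. An edge with an equal prefix
      -- is a survivor too, so its digit is heard.
      rcases h1.lt_or_eq with h1 | h1
      · omega
      · cases he : e i u' x' with
        | false => simp only [Bool.toNat_false]; omega
        | true =>
          have hs : surv i u' x' = true := (ih u' x').2
            ⟨hout', fun u'' x'' hr' h => (hmax u'' x'' (hr.trans hr') h).trans h1.ge⟩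
          have : heard i u = true := (hheard i (by omega) u).2 ⟨u', x', hr.symm, hs, he⟩
          rw [heq, this, h1]
    · rintro ⟨hout, hmax⟩
      have hh : Heaviest H F (fun u x => keyOf (fun j => e j u x) i) u x := by
        refine ⟨hout, fun u' x' hr h => ?_⟩
        have := hmax u' x' hr h
        simp only [keyOf] at this
        have := hle u x
        beta_reduce
        omega
      refine ⟨hh, ?_⟩
      rw [Bool.eq_iff_iff, hheard i (by omega)]
      constructor
      · exact fun he => ⟨u, x, SimpleGraph.Reachable.refl _, (ih u x).2 hh, he⟩
      · rintro ⟨v, y, hr, hs, he⟩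
        have hv := (ih v y).1 hs
        have h1 := hv.2 u x hr hout
        have h2 := hmax v y hr.symm hv.1
        simp only [keyOf, he] at h1 h2
        cases h : e i u x with
        | true => rfl
        | false => simp [h] at h2; omega

end Tournaments

/-! ### The computation of a spanning tree from scratch -/

namespace Boruvka

/-- The labels of the links: a global circuit for the clock, a global circuit that is used as long
as there are edges between different components, the circuits of the components, and messages that
are sent in a given direction. -/
inductive Label
  | clock
  | alarm
  | tree
  | msg (d : Direction)
  deriving Fintype

/-- The stages of a phase: finding the edges between different components, selecting the heaviest
outgoing edge of each component, where ties between edges of the same owner are broken by their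
axes, and merging. -/
inductive Mode
  | compare
  | select
  | tieA
  | tieB
  | merge
  | done
  deriving DecidableEq

instance : Fintype Mode :=
  ⟨{.compare, .select, .tieA, .tieB, .merge, .done}, fun m => by cases m <;> decide⟩

/-- The states. -/
structure State (P : ℕ) where
  mode : Mode
  /-- the position within the current period of the clock -/
  q : Fin (P + 1)
  /-- whether the amoebot keeps the clock running -/
  alive : Bool
  coin : Bool
  /-- whether the amoebot is a candidate in the tournament of its component -/
  cand : Bool
  /-- the coin heard from the candidates in the previous round -/
  prev : Bool
  nbr : Direction → Bool
  tree : Direction → Bool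
  /-- the directions of outgoing edges (that have not dropped out yet) -/
  mark : Direction → Bool
  /-- the current digits of the weights of the incident edges -/
  digit : Direction → Bool

instance (P : ℕ) : Finite (State P) :=
  Finite.of_injective (fun s : State P =>
    (s.mode, s.q, s.alive, s.coin, s.cand, s.prev, s.nbr, s.tree, s.mark, s.digit)) (by
    rintro ⟨⟩ ⟨⟩ h
    simpa using h)

variable {P : ℕ}

/-- Of the two endpoints of an edge, the owner is the one that sees it in one of these
directions. -/
def owns : Direction → Bool
  | .N | .ENE | .ESE => true
  | _ => false

/-- Edges in these directions win the first tie break. -/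
def axisA : Direction → Bool
  | .N | .S => true
  | _ => false

/-- Edges in these directions win the second tie break. -/
def axisB : Direction → Bool
  | .ENE | .WSW => true
  | _ => false

/-- The pin configurations. -/
def pins (s : State P) : Direction × Label → Direction × Label
  | (_, .clock) => (.N, .clock)
  | (_, .alarm) => (.N, .alarm)
  -- The pins off the tree are put into a set on which no amoebot beeps or listens.
  | (e, .tree) => if s.tree e = true then (.N, .tree) else (.S, .tree)
  | (e, .msg d) => (e, .msg d)

/-- Whether an amoebot beeps on the circuit of its component. -/
def Voice (s : State P) : Prop :=
  match s.mode with
  | .compare => s.cand = true ∧ s.coin = true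
  | .select | .tieA | .tieB => ∃ d, s.mark d = true ∧ s.digit d = true
  | _ => False

/-- The message to the neighbor in a given direction. -/
def talk (s : State P) (d : Direction) : Bool :=
  match s.mode with
  | .compare => s.prev
  | .select => s.coin
  | .merge => s.mark d
  | _ => false

/-- The activated partition sets. -/
def beep (s : State P) : Set (Direction × Label) :=
  {Q | (Q = (.N, .clock) ∧ s.alive = true) ∨ (Q = (.N, .alarm) ∧ ∃ d, s.mark d = true) ∨
    (Q = (.N, .tree) ∧ Voice s) ∨ ∃ d, Q = (d, .msg d) ∧ talk s d = true}

/-- The effect of the clock: at the end of a period in which nothing has been heard on its circuit,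
the stage ends. -/
def advance (s : State P) (hc x : Bool) (next : State P) : State P :=
  if s.q = Fin.last P ∧ hc = false then next
  -- Only the coin at the end of a period matters for the clock: tails silences the amoebot until
  -- the next stage.
  else { s with q := s.q + 1, alive := s.alive && (x || decide (s.q ≠ Fin.last P)) }

/-- The transition function, depending on whether beeps are heard on the circuits of the clock and
the alarm, on the circuit of the component, and from the neighbors. -/
def update (s : State P) (hc ha ht : Bool) (hm : Direction → Bool) (x : Bool) : State P :=
  match s.mode with
  | .compare =>
    let s' := { s with
      coin := x
      cand := s.cand && (s.coin == ht)
      prev := ht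
      mark := fun d => s.mark d || (s.nbr d && (hm d != s.prev)) }
    advance s' hc x (if ha then
        { s' with mode := .select, q := 0, alive := true, digit := fun _ => false }
      else { s' with mode := .done })
  | .select =>
    let s' := { s with
      coin := x
      mark := fun d => s.mark d && (s.digit d == ht)
      -- Amoebots send their coins to all neighbors, so both endpoints of an edge get the owner's
      -- coin in the same round.
      digit := fun d => if owns d then s.coin else hm d }
    advance s' hc x { s' with mode := .tieA, digit := axisA }
  | .tieA => { s with mode := .tieB, mark := fun d => s.mark d && (s.digit d == ht), digit := axisB }
  | .tieB => { s with mode := .merge, mark := fun d => s.mark d && (s.digit d == ht) }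
  | .merge =>
    { s with
      mode := .compare
      q := 0
      alive := true
      cand := true
      prev := false
      tree := fun d => s.tree d || s.mark d || (s.nbr d && hm d)
      mark := fun _ => false }
  | .done => s

open scoped Classical in
/-- The machine that computes a spanning tree; `P + 1` is the length of the period of its clock. -/
noncomputable def machine (P : ℕ) : Machine Label Bool Unit (Set Direction) where
  State := State P
  finite := inferInstance
  init nb _ :=
    { mode := .compare, q := 0, alive := true, coin := false, cand := true, prev := false
      nbr := fun d => decide (d ∈ nb), tree := fun _ => false, mark := fun _ => false
      digit := fun _ => false }
  step s r x := update s (decide ((.N, .clock) ∈ r)) (decide ((.N, .alarm) ∈ r))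
    (decide ((.N, .tree) ∈ r)) (fun d => decide ((d, .msg d.opp) ∈ r)) x
  pins := pins
  beep := beep
  output s := match s.mode with
    | .done => some {d | s.tree d = true}
    | _ => none
  output_step := by
    intro s r x o h
    cases hm : s.mode <;> simp [hm] at h
    simpa [update, hm] using h

/-! ### Executions as sequences of rounds on a forest -/

variable {S : Finset Node}

/-- The amoebots know their neighbors, and the current forest is `F`. -/
structure Base (F : SimpleGraph S) (s : S → State P) : Prop where
  nbr : ∀ u d, (s u).nbr d = true ↔ ∃ v : S, v.1 = u.1 + d.vec
  tree : ∀ u d, (s u).tree d = true ↔ ∃ v : S, v.1 = u.1 + d.vec ∧ F.Adj u v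

open scoped Classical in
/-- The amoebots perform a round. -/
def Round (F : SimpleGraph S) (s s' : S → State P) (x : S → Bool) : Prop :=
  ∃ hm : S → Direction → Bool,
    (∀ (u v : S) (d : Direction), v.1 = u.1 + d.vec → hm u d = talk (s v) d.opp) ∧
    ∀ u, s' u = update (s u) (decide (∃ v, (s v).alive = true))
      (decide (∃ v d, (s v).mark d = true)) (decide (∃ v, F.Reachable v u ∧ Voice (s v)))
      (hm u) (x u)

/-- The states `s` and coins `x` form an execution. -/
def Exec (s : ℕ → S → State P) (x : ℕ → S → Bool) : Prop :=
  ∀ (t : ℕ) (F : SimpleGraph S), F ≤ structureGraph S → Base F (s t) →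
    Round F (s t) (s (t + 1)) (x t)

lemma Exec.shift {s : ℕ → S → State P} {x : ℕ → S → Bool} (h : Exec s x) (t₀ : ℕ) :
    Exec (fun t => s (t₀ + t)) (fun t => x (t₀ + t)) :=
  fun t F hF hB => h (t₀ + t) F hF hB

/-- The pins of the clock and of the alarm join everything, those of the tree circuits follow `F` by
`Base`, and each message label is a private wire between neighbors. All details of circuits are
confined to this lemma. -/
lemma exec_run (hS : (structureGraph S).Connected) (ω : ℕ → S → Bool) :
    Exec ((machine P).run S (fun _ => ()) ω) ω := by
  classical
  intro t F hF hB
  set s := (machine P).run S (fun _ => ()) ω t with hs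
  set r := fun u => hears S (fun v => pins (s v)) (fun v => beep (s v)) u with hr
  have hclock : ∀ u, (.N, .clock) ∈ r u ↔ ∃ v, (s v).alive = true := by
    intro u
    rw [hr, mem_hears_component (F := structureGraph S) le_rfl]
    · simp only [beep, Set.mem_ofPred_eq, Prod.mk.injEq, reduceCtorEq, and_false, false_and,
        true_and, exists_false, or_false]
      exact ⟨fun ⟨v, _, h⟩ => ⟨v, h⟩, fun ⟨v, h⟩ => ⟨v, hS.preconnected _ _, h⟩⟩
    · intro v w d hw
      simp only [pins, true_iff]
      exact structureGraph_adj.2 ⟨d, hw⟩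
    · intro v d l hl
      cases l <;> simp [pins] at hl ⊢
      split_ifs at hl <;> simp at hl
  have halarm : ∀ u, (.N, .alarm) ∈ r u ↔ ∃ v d, (s v).mark d = true := by
    intro u
    rw [hr, mem_hears_component (F := structureGraph S) le_rfl]
    · simp only [beep, Set.mem_ofPred_eq, Prod.mk.injEq, reduceCtorEq, and_false, false_and,
        true_and, exists_false, or_false, false_or]
      exact ⟨fun ⟨v, _, h⟩ => ⟨v, h⟩, fun ⟨v, h⟩ => ⟨v, hS.preconnected _ _, h⟩⟩
    · intro v w d hw
      simp only [pins, true_iff]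
      exact structureGraph_adj.2 ⟨d, hw⟩
    · intro v d l hl
      cases l <;> simp [pins] at hl ⊢
      split_ifs at hl <;> simp at hl
  have htree : ∀ u, (.N, .tree) ∈ r u ↔ ∃ v, F.Reachable v u ∧ Voice (s v) := by
    intro u
    rw [hr, mem_hears_component hF]
    · simp only [beep, Set.mem_ofPred_eq, Prod.mk.injEq, reduceCtorEq, and_false, false_and,
        true_and, exists_false, or_false, false_or]
    · intro v w d hw
      simp only [pins]
      split_ifs with h
      · obtain ⟨w', hw', hadj⟩ := (hB.tree v d).1 h
        obtain rfl : w' = w := Subtype.ext (hw'.trans hw.symm)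
        simpa using hadj
      · simp only [Prod.mk.injEq, reduceCtorEq, false_and, false_iff]
        exact fun hadj => h ((hB.tree v d).2 ⟨w, hw, hadj⟩)
    · intro v d l hl
      cases l <;> simp [pins] at hl ⊢
  refine ⟨fun u d => decide ((d, .msg d.opp) ∈ r u), ?_, ?_⟩
  · intro u v d hv
    rw [hr, Bool.eq_iff_iff, decide_eq_true_eq, mem_hears_message _ _ hv]
    · simp only [beep, Set.mem_ofPred_eq, Prod.mk.injEq, reduceCtorEq, and_false, false_and,
        Label.msg.injEq, false_or]
      constructor
      · rintro (⟨e, ⟨rfl, h⟩, _⟩ | ⟨e, ⟨rfl, _⟩, h⟩)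
        · exact absurd h (Direction.opp_ne _)
        · exact h
      · exact fun h => Or.inr ⟨_, ⟨rfl, rfl⟩, h⟩
    · intro v e
      rfl
    · intro v e e' l hl
      cases l <;> simp [pins] at hl ⊢
      · split_ifs at hl <;> simp at hl
      · exact hl.2
  · intro u
    change update (s u) (decide ((.N, .clock) ∈ r u)) (decide ((.N, .alarm) ∈ r u))
      (decide ((.N, .tree) ∈ r u)) (fun d => decide ((d, .msg d.opp) ∈ r u)) (ω t u) = _
    simp only [hclock, halarm, htree]

/-! ### The effect of a transition in each mode -/

section Update

variable {s : State P} {hc ha ht : Bool} {hm : Direction → Bool} {x : Bool}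

lemma update_nbr : (update s hc ha ht hm x).nbr = s.nbr := by
  unfold update
  split <;> simp only [advance] <;> split_ifs <;> rfl

lemma update_tree (h : s.mode ≠ .merge) : (update s hc ha ht hm x).tree = s.tree := by
  unfold update
  split <;> simp only [advance] <;> first | (split_ifs <;> rfl) | rfl | exact absurd ‹_› h

lemma update_compare (h : s.mode = .compare) :
    (update s hc ha ht hm x).coin = x ∧
    (update s hc ha ht hm x).cand = (s.cand && (s.coin == ht)) ∧
    (update s hc ha ht hm x).prev = ht ∧
    ∀ d, (update s hc ha ht hm x).mark d = (s.mark d || (s.nbr d && (hm d != s.prev))) := by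
  unfold update
  simp only [h, advance]
  split_ifs <;> exact ⟨rfl, rfl, rfl, fun _ => rfl⟩

lemma update_compare_end (h : s.mode = .compare) (hq : s.q = Fin.last P) :
    ((update s false true ht hm x).mode = .select ∧ (update s false true ht hm x).q = 0 ∧
      (update s false true ht hm x).alive = true ∧
      (update s false true ht hm x).digit = fun _ => false) ∧
    (update s false false ht hm x).mode = .done := by
  unfold update
  simp [h, hq, advance]

lemma update_select (h : s.mode = .select) :
    (update s hc ha ht hm x).coin = x ∧
    ∀ d, (update s hc ha ht hm x).mark d = (s.mark d && (s.digit d == ht)) := by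
  unfold update
  simp only [h, advance]
  split_ifs <;> exact ⟨rfl, fun _ => rfl⟩

lemma update_select_digit (h : s.mode = .select) (hq : s.q ≠ Fin.last P ∨ hc = true)
    (d : Direction) :
    (update s hc ha ht hm x).digit d = if owns d then s.coin else hm d := by
  unfold update
  simp only [h, advance]
  rw [if_neg (by rintro ⟨h1, h2⟩; rcases hq with h | h <;> simp_all)]

lemma update_select_end (h : s.mode = .select) (hq : s.q = Fin.last P) :
    (update s false ha ht hm x).mode = .tieA ∧ (update s false ha ht hm x).digit = axisA := by
  unfold update
  simp [h, hq, advance]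

lemma update_tieA (h : s.mode = .tieA) :
    (update s hc ha ht hm x).mode = .tieB ∧ (update s hc ha ht hm x).digit = axisB ∧
    ∀ d, (update s hc ha ht hm x).mark d = (s.mark d && (s.digit d == ht)) := by
  unfold update
  simp [h]

lemma update_tieB (h : s.mode = .tieB) :
    (update s hc ha ht hm x).mode = .merge ∧
    ∀ d, (update s hc ha ht hm x).mark d = (s.mark d && (s.digit d == ht)) := by
  unfold update
  simp [h]

lemma update_stay (h : s.mode = .compare ∨ s.mode = .select)
    (hq : s.q ≠ Fin.last P ∨ hc = true) :
    (update s hc ha ht hm x).mode = s.mode ∧ (update s hc ha ht hm x).q = s.q + 1 ∧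
    (update s hc ha ht hm x).alive = (s.alive && (x || decide (s.q ≠ Fin.last P))) := by
  have hn : ¬ (s.q = Fin.last P ∧ hc = false) := by
    rintro ⟨h1, h2⟩; rcases hq with h | h <;> simp_all
  unfold update
  rcases h with h | h <;> simp only [h, advance] <;> rw [if_neg hn] <;>
    exact ⟨rfl, rfl, rfl⟩

end Update

lemma Base.round {F : SimpleGraph S} {s s' : S → State P} {x : S → Bool} (hB : Base F s)
    (hr : Round F s s' x) (hmode : ∀ u, (s u).mode ≠ .merge) : Base F s' := by
  obtain ⟨hm, _, h⟩ := hr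
  constructor
  · intro u d
    rw [h, update_nbr, hB.nbr]
  · intro u d
    rw [h, update_tree (hmode u), hB.tree]

/-- A stage that is controlled by the clock. -/
lemma exists_stage {s : ℕ → S → State P} {x : ℕ → S → Bool} (hex : Exec s x)
    {F : SimpleGraph S} (hF : F ≤ structureGraph S) (hB : Base F (s 0)) {m : Mode}
    (hm : m = .compare ∨ m = .select)
    (h0 : ∀ u, (s 0 u).mode = m ∧ (s 0 u).q = 0 ∧ (s 0 u).alive = true) {τ₀ τ₁ : ℕ}
    (hlow : ∃ u, ∀ i < τ₀, x (P + i * (P + 1)) u = true)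
    (hupp : ∀ u, ∃ i < τ₁, x (P + i * (P + 1)) u = false) :
    ∃ ℓ, (τ₀ + 2) * (P + 1) ≤ ℓ + 1 ∧ ℓ + 1 ≤ (τ₁ + 1) * (P + 1) ∧
      (∀ t ≤ ℓ, Base F (s t) ∧ (∀ u, (s t u).mode = m) ∧
        (t < ℓ → ∀ u, (s t u).q ≠ Fin.last P ∨ ∃ v, (s t v).alive = true)) ∧
      (∀ u, (s ℓ u).q = Fin.last P) ∧ ¬ ∃ v, (s ℓ v).alive = true := by
  classical
  have hend : ∃ i, ¬ ∃ u, ∀ j < i, x (P + j * (P + 1)) u = true := by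
    refine ⟨τ₁, ?_⟩
    rintro ⟨u, hu⟩
    obtain ⟨i, hi, hxi⟩ := hupp u
    rw [hu i hi] at hxi
    exact absurd hxi (by decide)
  -- `e` is the first number of periods that no amoebot has survived. One further period passes
  -- before the silence is noticed at its end, so the stage takes `(e + 1) * (P + 1)` rounds.
  set e := Nat.find hend with he
  have hespec := Nat.find_spec hend
  have hemin : ∀ i < e, ∃ u, ∀ j < i, x (P + j * (P + 1)) u = true :=
    fun i hi => not_not.1 (Nat.find_min hend hi)
  have he1 : e ≤ τ₁ := by
    refine Nat.find_min' hend ?_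
    rintro ⟨u, hu⟩
    obtain ⟨i, hi, hxi⟩ := hupp u
    rw [hu i hi] at hxi
    exact absurd hxi (by decide)
  have he0 : τ₀ < e := by
    by_contra hlt
    obtain ⟨u, hu⟩ := hlow
    exact hespec ⟨u, fun j hj => hu j (lt_of_lt_of_le hj (not_lt.1 hlt))⟩
  have hinv : ∀ t, t < (e + 1) * (P + 1) → Base F (s t) ∧ ∀ u, (s t u).mode = m ∧
      (s t u).q.val = t % (P + 1) ∧
      ((s t u).alive = true ↔ ∀ j < t / (P + 1), x (P + j * (P + 1)) u = true) := by
    intro t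
    induction t with
    | zero =>
      intro _
      refine ⟨hB, fun u => ?_⟩
      obtain ⟨h1, h2, h3⟩ := h0 u
      simp [h1, h2, h3]
    | succ t ih =>
      intro ht
      obtain ⟨hBt, hu⟩ := ih (by omega)
      have hround := hex t F hF hBt
      have hmode : ∀ u, (s t u).mode ≠ .merge := by
        intro u
        rw [(hu u).1]
        rcases hm with rfl | rfl <;> simp
      refine ⟨hBt.round hround hmode, fun u => ?_⟩
      obtain ⟨msg, _, hs⟩ := hround
      obtain ⟨h1, h2, h3⟩ := hu u
      have hdm := Nat.div_add_mod t (P + 1)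
      by_cases hq : t % (P + 1) = P
      · have hlast : (s t u).q = Fin.last P := Fin.ext (by rw [h2, hq]; rfl)
        have ht1 : t + 1 = (t / (P + 1) + 1) * (P + 1) := by
          rw [hq] at hdm; nlinarith
        have hlt : t / (P + 1) < e := by
          rw [ht1] at ht
          have := Nat.lt_of_mul_lt_mul_right ht
          omega
        have hal : ∃ v, (s t v).alive = true := by
          obtain ⟨v, hv⟩ := hemin _ hlt
          exact ⟨v, (hu v).2.2.2 hv⟩
        have hst := update_stay (s := s t u) (hc := decide (∃ v, (s t v).alive = true))
          (ha := decide (∃ v d, (s t v).mark d = true))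
          (ht := decide (∃ v, F.Reachable v u ∧ Voice (s t v))) (hm := msg u) (x := x t u)
          (by rw [h1]; exact hm) (Or.inr (by simpa using hal))
        rw [← hs u] at hst
        obtain ⟨g1, g2, g3⟩ := hst
        refine ⟨g1.trans h1, ?_, ?_⟩
        · rw [g2, hlast, ht1]
          simp
        · have hdiv : (t + 1) / (P + 1) = t / (P + 1) + 1 := by
            rw [ht1]; exact Nat.mul_div_cancel _ (by omega)
          have htt : t = P + t / (P + 1) * (P + 1) := by
            rw [hq] at hdm; nlinarith
          rw [g3, hdiv, hlast, Bool.and_eq_true, h3]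
          simp only [ne_eq, not_true_eq_false, decide_false, Bool.or_false]
          constructor
          · rintro ⟨ha, hb⟩ j hj
            rcases Nat.lt_succ_iff_lt_or_eq.1 hj with hj | rfl
            · exact ha j hj
            · rwa [htt] at hb
          · intro ha
            refine ⟨fun j hj => ha j (by omega), ?_⟩
            rw [htt]
            exact ha _ (by omega)
      · have hnl : (s t u).q ≠ Fin.last P := by
          intro hl
          rw [hl] at h2
          exact hq h2.symm
        have hst := update_stay (s := s t u) (hc := decide (∃ v, (s t v).alive = true))
          (ha := decide (∃ v d, (s t v).mark d = true))
          (ht := decide (∃ v, F.Reachable v u ∧ Voice (s t v))) (hm := msg u) (x := x t u)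
          (by rw [h1]; exact hm) (Or.inl hnl)
        rw [← hs u] at hst
        obtain ⟨g1, g2, g3⟩ := hst
        have hlt := Nat.mod_lt t (show 0 < P + 1 by omega)
        have hdiv : (t + 1) / (P + 1) = t / (P + 1) := by
          refine Nat.div_eq_of_lt_le ?_ ?_ <;> nlinarith [show t % (P + 1) < P by omega]
        have hmod : (t + 1) % (P + 1) = t % (P + 1) + 1 := by
          have := Nat.div_add_mod (t + 1) (P + 1)
          rw [hdiv] at this
          omega
        refine ⟨g1.trans h1, ?_, ?_⟩
        · rw [g2, Fin.val_add_one, if_neg hnl, h2, hmod]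
        · rw [g3, hdiv]
          simpa [hnl] using h3
  have hpos : 0 < (e + 1) * (P + 1) := by positivity
  refine ⟨(e + 1) * (P + 1) - 1, ?_, ?_, ?_, ?_, ?_⟩
  · rw [Nat.sub_add_cancel hpos]
    exact Nat.mul_le_mul_right _ (by omega)
  · rw [Nat.sub_add_cancel hpos]
    exact Nat.mul_le_mul_right _ (by omega)
  · intro t ht
    obtain ⟨hBt, hu⟩ := hinv t (by omega)
    refine ⟨hBt, fun u => (hu u).1, fun htl u => ?_⟩
    by_cases hq : t % (P + 1) = P
    · right
      have hdm := Nat.div_add_mod t (P + 1)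
      have ht1 : t + 1 = (t / (P + 1) + 1) * (P + 1) := by
        rw [hq] at hdm; nlinarith
      have hlt : t / (P + 1) < e := by
        have h' : t + 1 < (e + 1) * (P + 1) := by omega
        rw [ht1] at h'
        have := Nat.lt_of_mul_lt_mul_right h'
        omega
      obtain ⟨v, hv⟩ := hemin _ hlt
      exact ⟨v, (hu v).2.2.2 hv⟩
    · left
      intro hl
      have := (hu u).2.1
      rw [hl] at this
      exact hq this.symm
  · intro u
    obtain ⟨_, hu⟩ := hinv ((e + 1) * (P + 1) - 1) (by omega)
    apply Fin.ext
    rw [(hu u).2.1]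
    have : (e + 1) * (P + 1) - 1 = P + (P + 1) * e := by
      have : (e + 1) * (P + 1) = (P + 1) * e + (P + 1) := by ring
      omega
    rw [this, Nat.add_mul_mod_self_left, Nat.mod_eq_of_lt (by omega)]
    rfl
  · rintro ⟨v, hv⟩
    obtain ⟨_, hu⟩ := hinv ((e + 1) * (P + 1) - 1) (by omega)
    have hdiv : ((e + 1) * (P + 1) - 1) / (P + 1) = e := by
      have : (e + 1) * (P + 1) - 1 = P + (P + 1) * e := by
        have : (e + 1) * (P + 1) = (P + 1) * e + (P + 1) := by ring
        omega
      rw [this, Nat.add_mul_div_left _ _ (by omega), Nat.div_eq_of_lt (by omega), zero_add]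
    have := (hu v).2.2.1 hv
    rw [hdiv] at this
    exact hespec ⟨v, this⟩

end Boruvka

/-! ### The phases and their correctness for good coins -/

namespace Boruvka

variable {P : ℕ} {S : Finset Node}

/-- The situation at the beginning of a phase. -/
structure Start (F : SimpleGraph S) (s : S → State P) : Prop where
  base : Base F s
  ready : ∀ u, (s u).mode = .compare ∧ (s u).q = 0 ∧ (s u).alive = true
  cand : ∀ u, (s u).cand = true
  prev : ∀ u, (s u).prev = false
  mark : ∀ u d, (s u).mark d = false

/-- The situation at the beginning of the second stage of a phase. -/
structure Selecting (F : SimpleGraph S) (s : S → State P) : Prop where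
  base : Base F s
  ready : ∀ u, (s u).mode = .select ∧ (s u).q = 0 ∧ (s u).alive = true
  digit : ∀ u d, (s u).digit d = false
  mark : ∀ u d, (s u).mark d = true ↔ ∃ v : S, v.1 = u.1 + d.vec ∧ ¬ F.Reachable u v

/-- The coins after time `s` are good if the coins of any two amoebots are different within the
next `T` rounds, and some amoebot keeps the clock running for `τ₀` periods, but no amoebot does so
for `τ₁` periods. -/
structure GoodAt (P T τ₀ τ₁ : ℕ) (x : ℕ → S → Bool) (s : ℕ) : Prop where
  diff : ∀ a b, a ≠ b → ∃ i < T, x (s + i) a ≠ x (s + i) b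
  low : ∃ u, ∀ i < τ₀, x (s + i * (P + 1)) u = true
  upp : ∀ u, ∃ i < τ₁, x (s + i * (P + 1)) u = false

variable {s : ℕ → S → State P} {x : ℕ → S → Bool} {F : SimpleGraph S} {T τ₀ τ₁ : ℕ}

/-- At the end of the first stage of a phase, the edges between different components are known. -/
lemma compare_stage (hex : Exec s x) (hF : F ≤ structureGraph S) (hs : Start F (s 0))
    (hg : ∀ t ≤ P, GoodAt P T τ₀ τ₁ x t) (hT : T + 3 ≤ (τ₀ + 2) * (P + 1)) :
    ∃ ℓ, ℓ ≤ (τ₁ + 1) * (P + 1) ∧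
      ((∃ u v, Outgoing (structureGraph S) F u v) ∧ Selecting F (s ℓ) ∨
        (¬ ∃ u v, Outgoing (structureGraph S) F u v) ∧ Base F (s ℓ) ∧
          ∀ u, (s ℓ u).mode = .done) := by
  classical
  -- The clock uses the coins at the ends of periods, the first of which is at time `P`; hence
  -- goodness at `P`.
  obtain ⟨ℓ, hℓ0, hℓ1, hstage, hlast, hdead⟩ := exists_stage hex hF hs.base (Or.inl rfl) hs.ready
    (hg P le_rfl).low (hg P le_rfl).upp
  have hbase : ∀ t ≤ ℓ, Base F (s t) := fun t ht => (hstage t ht).1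
  have hmode : ∀ t ≤ ℓ, ∀ u, (s t u).mode = .compare := fun t ht => (hstage t ht).2.1
  have hround : ∀ t ≤ ℓ, Round F (s t) (s (t + 1)) (x t) := fun t ht => hex t F hF (hbase t ht)
  set heard : ℕ → S → Bool := fun t u => decide (∃ v, F.Reachable v u ∧ Voice (s t v)) with hheard
  have hupd : ∀ t ≤ ℓ, ∀ u, (s (t + 1) u).coin = x t u ∧
      (s (t + 1) u).cand = ((s t u).cand && ((s t u).coin == heard t u)) ∧
      (s (t + 1) u).prev = heard t u ∧
      ∀ (v : S) d, v.1 = u.1 + d.vec → (s (t + 1) u).mark d =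
        ((s t u).mark d || ((s t v).prev != (s t u).prev)) := by
    intro t ht u
    obtain ⟨hm, hmsg, h⟩ := hround t ht
    obtain ⟨h1, h2, h3, h4⟩ := update_compare (hc := decide (∃ v, (s t v).alive = true))
      (ha := decide (∃ v d, (s t v).mark d = true)) (ht := heard t u) (hm := hm u) (x := x t u)
      (hmode t ht u)
    rw [← h u] at h1 h2 h3 h4
    refine ⟨h1, h2, h3, fun v d hv => ?_⟩
    rw [h4, hmsg u v d hv, ((hbase t ht).nbr u d).2 ⟨v, hv⟩]
    simp [talk, hmode t ht v]
  have hnomark : ∀ t ≤ ℓ + 1, ∀ u d, (s t u).mark d = true → ∃ v : S, v.1 = u.1 + d.vec := by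
    intro t
    induction t with
    | zero => intro _ u d h; rw [hs.mark] at h; exact absurd h (by decide)
    | succ t ih =>
      intro ht u d h
      obtain ⟨hm, _, hr⟩ := hround t (by omega)
      rw [hr u, (update_compare (hmode t (by omega) u)).2.2.2, Bool.or_eq_true,
        Bool.and_eq_true] at h
      rcases h with h | h
      · exact ih (by omega) u d h
      · exact ((hbase t (by omega)).nbr u d).1 h.1
  have hprev : ∀ t ≤ ℓ + 1, ∀ (u v : S) d, v.1 = u.1 + d.vec →
      ((s t u).mark d = true ↔ ∃ j < t, (s j u).prev ≠ (s j v).prev) := by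
    intro t
    induction t with
    | zero => intro _ u v d _; simp [hs.mark]
    | succ t ih =>
      intro ht u v d hv
      rw [(hupd t (by omega) u).2.2.2 v d hv, Bool.or_eq_true, ih (by omega) u v d hv, bne_iff_ne]
      constructor
      · rintro (⟨j, hj, h⟩ | h)
        · exact ⟨j, by omega, h⟩
        · exact ⟨t, by omega, h.symm⟩
      · rintro ⟨j, hj, h⟩
        rcases Nat.lt_succ_iff_lt_or_eq.1 hj with hj | rfl
        · exact Or.inl ⟨j, hj, h⟩
        · exact Or.inr h.symm
  have htour := fun L (hL : L ≤ ℓ) => compare_tournament (F := F) (ℓ := L)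
    (coin := fun t u => (s t u).coin) (cand := fun t u => (s t u).cand) (heard := heard)
    (by
      intro i hi u
      refine decide_eq_true_iff.trans (exists_congr fun v => and_congr_right fun _ => ?_)
      simp only [Voice, hmode i (show i ≤ ℓ by omega) v])
    (fun i hi u => (hupd i (by omega) u).2.1) hs.cand
  -- The marks have to be final already at time `ℓ`, since the alarm of this last round decides
  -- whether the algorithm ends.
  have hmark : ∀ t, ℓ ≤ t → t ≤ ℓ + 1 → ∀ u d,
      ((s t u).mark d = true ↔ ∃ v : S, v.1 = u.1 + d.vec ∧ ¬ F.Reachable u v) := by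
    intro t ht0 ht1 u d
    constructor
    · intro h
      obtain ⟨v, hv⟩ := hnomark t ht1 u d h
      obtain ⟨j, hj, hne⟩ := (hprev t ht1 u v d hv).1 h
      refine ⟨v, hv, fun hr => hne ?_⟩
      cases j with
      | zero => rw [hs.prev, hs.prev]
      | succ j =>
        rw [(hupd j (by omega) u).2.2.1, (hupd j (by omega) v).2.2.1]
        exact (htour ℓ le_rfl u v).1 hr j (by omega)
    · rintro ⟨v, hv, hr⟩
      rw [hprev t ht1 u v d hv]
      -- The tournament is cut at `ℓ - 1` because what is heard at time `i` is exchanged at time `i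
      -- + 1` and marked only afterwards. Coins are stored for a round before use; these delays make
      -- up the 3 in `hT`.
      obtain ⟨i, hi1, hi, hne⟩ := (htour (ℓ - 1) (by omega) u v).2 (by
        intro a b hab
        obtain ⟨i, hi, hne⟩ := (hg 0 (by omega)).diff a b hab
        rw [zero_add] at hne
        refine ⟨i + 1, by omega, by omega, ?_⟩
        rwa [(hupd i (by omega) a).1, (hupd i (by omega) b).1]) hr
      refine ⟨i + 1, by omega, ?_⟩
      rwa [(hupd i (by omega) u).2.2.1, (hupd i (by omega) v).2.2.1]
  have hout : (∃ u v, Outgoing (structureGraph S) F u v) ↔ ∃ v d, (s ℓ v).mark d = true := by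
    constructor
    · rintro ⟨u, v, hadj, hr⟩
      obtain ⟨d, hd⟩ := structureGraph_adj.1 hadj
      exact ⟨u, d, (hmark ℓ le_rfl (by omega) u d).2 ⟨v, hd, hr⟩⟩
    · rintro ⟨u, d, h⟩
      obtain ⟨v, hv, hr⟩ := (hmark ℓ le_rfl (by omega) u d).1 h
      exact ⟨u, v, structureGraph_adj.2 ⟨d, hv⟩, hr⟩
  have hbase' : Base F (s (ℓ + 1)) := (hbase ℓ le_rfl).round (hround ℓ le_rfl)
    (fun u => by rw [hmode ℓ le_rfl]; simp)
  refine ⟨ℓ + 1, hℓ1, ?_⟩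
  obtain ⟨hm, _, h⟩ := hround ℓ le_rfl
  rw [decide_eq_false hdead] at h
  by_cases ho : ∃ u v, Outgoing (structureGraph S) F u v
  · rw [decide_eq_true (hout.1 ho)] at h
    have he := fun u => (update_compare_end (hm := hm u) (x := x ℓ u) (ht := heard ℓ u)
      (hmode ℓ le_rfl u) (hlast u)).1
    refine Or.inl ⟨ho, hbase', fun u => ?_, fun u d => ?_, hmark _ (by omega) le_rfl⟩
    · rw [h u]
      exact ⟨(he u).1, (he u).2.1, (he u).2.2.1⟩
    · rw [h u, (he u).2.2.2]
  · rw [decide_eq_false (hout.not.1 ho)] at h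
    refine Or.inr ⟨ho, hbase', fun u => ?_⟩
    rw [h u]
    exact (update_compare_end (hmode ℓ le_rfl u) (hlast u)).2

/-- The value of a function of directions at the direction from `u` to `v`. -/
noncomputable def onDir (f : Direction → Bool) (u v : Node) : Bool :=
  match dirTo u v with
  | some d => f d
  | none => false

lemma onDir_eq {f : Direction → Bool} {u v : Node} {d : Direction} (h : v = u + d.vec) :
    onDir f u v = f d := by
  unfold onDir
  rw [dirTo_eq_some.2 h]

lemma onDir_eq_true {f : Direction → Bool} {u v : Node} :
    onDir f u v = true ↔ ∃ d : Direction, v = u + d.vec ∧ f d = true := by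
  constructor
  · intro h
    unfold onDir at h
    split at h
    · next d hd => exact ⟨d, dirTo_eq_some.1 hd, h⟩
    · exact absurd h (by decide)
  · rintro ⟨d, hd, h⟩
    rwa [onDir_eq hd]

lemma owns_opp (d : Direction) : owns d.opp = !owns d := by cases d <;> rfl

lemma axisA_opp (d : Direction) : axisA d.opp = axisA d := by cases d <;> rfl

lemma axisB_opp (d : Direction) : axisB d.opp = axisB d := by cases d <;> rfl

/-- Two bits distinguish the three axes of the grid. -/
lemma eq_or_eq_opp_of_axis {d e : Direction} (hA : axisA d = axisA e) (hB : axisB d = axisB e) :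
    e = d ∨ e = d.opp := by
  revert hA hB
  cases d <;> cases e <;> decide

/-- In the second stage of a phase, each component is merged along its heaviest outgoing edge. -/
lemma select_stage (hex : Exec s x) (hF : F ≤ structureGraph S) (hs : Selecting F (s 0))
    (hg : ∀ t ≤ P, GoodAt P T τ₀ τ₁ x t) (hT : T + 3 ≤ (τ₀ + 2) * (P + 1)) :
    ∃ ℓ, ℓ ≤ (τ₁ + 1) * (P + 1) + 3 ∧ ∃ w : S → S → ℕ,
      (∀ u v, Outgoing (structureGraph S) F u v → w u v = w v u) ∧
      (∀ u v u' v', Outgoing (structureGraph S) F u v → Outgoing (structureGraph S) F u' v' →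
        w u v = w u' v' → (u = u' ∧ v = v') ∨ (u = v' ∧ v = u')) ∧
      Start (mergeForest (structureGraph S) F w) (s ℓ) := by
  classical
  obtain ⟨ℓ, hℓ0, hℓ1, hstage, hlast, hdead⟩ := exists_stage hex hF hs.base (Or.inr rfl) hs.ready
    (hg P le_rfl).low (hg P le_rfl).upp
  have hmode : ∀ t ≤ ℓ, ∀ u, (s t u).mode = .select := fun t ht => (hstage t ht).2.1
  set heard : ℕ → S → Bool := fun t u => decide (∃ v, F.Reachable v u ∧ Voice (s t v)) with hheard
  -- the stages and digits
  have hround0 : ∀ t ≤ ℓ, Round F (s t) (s (t + 1)) (x t) :=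
    fun t ht => hex t F hF (hstage t ht).1
  have hbase1 : Base F (s (ℓ + 1)) := (hstage ℓ le_rfl).1.round (hround0 ℓ le_rfl)
    (fun u => by rw [hmode ℓ le_rfl]; simp)
  have hround1 := hex (ℓ + 1) F hF hbase1
  have hA : ∀ u, (s (ℓ + 1) u).mode = .tieA ∧ (s (ℓ + 1) u).digit = axisA := by
    intro u
    obtain ⟨hm, _, h⟩ := hround0 ℓ le_rfl
    rw [decide_eq_false hdead] at h
    rw [h u]
    exact update_select_end (hmode ℓ le_rfl u) (hlast u)
  have hbase2 : Base F (s (ℓ + 2)) := hbase1.round hround1 (fun u => by rw [(hA u).1]; simp)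
  have hround2 := hex (ℓ + 2) F hF hbase2
  have hB : ∀ u, (s (ℓ + 2) u).mode = .tieB ∧ (s (ℓ + 2) u).digit = axisB := by
    intro u
    obtain ⟨hm, _, h⟩ := hround1
    rw [h u]
    obtain ⟨h1, h2, _⟩ := update_tieA (hc := decide (∃ v, (s (ℓ + 1) v).alive = true))
      (ha := decide (∃ v d, (s (ℓ + 1) v).mark d = true)) (ht := heard (ℓ + 1) u) (hm := hm u)
      (x := x (ℓ + 1) u) (hA u).1
    exact ⟨h1, h2⟩
  have hbase3 : Base F (s (ℓ + 3)) := hbase2.round hround2 (fun u => by rw [(hB u).1]; simp)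
  have hround3 := hex (ℓ + 3) F hF hbase3
  have hM : ∀ u, (s (ℓ + 3) u).mode = .merge := by
    intro u
    obtain ⟨hm, _, h⟩ := hround2
    rw [h u]
    exact (update_tieB (hB u).1).1
  have hcoin : ∀ t ≤ ℓ, ∀ u, (s (t + 1) u).coin = x t u := by
    intro t ht u
    obtain ⟨hm, _, h⟩ := hround0 t ht
    rw [h u]
    exact (update_select (hmode t ht u)).1
  have hdigit : ∀ t < ℓ, ∀ (u v : S) d, v.1 = u.1 + d.vec →
      (s (t + 1) u).digit d = if owns d then (s t u).coin else (s t v).coin := by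
    intro t ht u v d hv
    obtain ⟨hm, hmsg, h⟩ := hround0 t ht.le
    rw [h u, update_select_digit (hmode t ht.le u) (by
      rw [decide_eq_true_eq]; exact (hstage t ht.le).2.2 ht u), hmsg u v d hv]
    simp [talk, hmode t ht.le v]
  have hmarkstep : ∀ t < ℓ + 3, ∀ u d, (s (t + 1) u).mark d =
      ((s t u).mark d && ((s t u).digit d == heard t u)) := by
    intro t ht u d
    rcases lt_trichotomy t (ℓ + 1) with h | rfl | h
    · obtain ⟨hm, _, h'⟩ := hround0 t (by omega)
      rw [h' u]
      exact (update_select (hmode t (by omega) u)).2 d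
    · obtain ⟨hm, _, h'⟩ := hround1
      rw [h' u]
      exact (update_tieA (hA u).1).2.2 d
    · obtain rfl : t = ℓ + 2 := by omega
      obtain ⟨hm, _, h'⟩ := hround2
      rw [h' u]
      exact (update_tieB (hB u).1).2 d
  have hvoice : ∀ t < ℓ + 3, ∀ u, Voice (s t u) ↔
      ∃ d, (s t u).mark d = true ∧ (s t u).digit d = true := by
    intro t ht u
    rcases lt_trichotomy t (ℓ + 1) with h | rfl | h
    · simp only [Voice, hmode t (by omega) u]
    · simp only [Voice, (hA u).1]
    · obtain rfl : t = ℓ + 2 := by omega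
      simp only [Voice, (hB u).1]
  have hnbr : ∀ t ≤ ℓ + 3, ∀ u d, (s t u).mark d = true → ∃ v : S, v.1 = u.1 + d.vec := by
    intro t
    induction t with
    | zero => intro _ u d h; obtain ⟨v, hv, _⟩ := (hs.mark u d).1 h; exact ⟨v, hv⟩
    | succ t ih =>
      intro ht u d h
      rw [hmarkstep t (by omega), Bool.and_eq_true] at h
      exact ih (by omega) u d h.1
  set e : ℕ → S → S → Bool := fun t u v => onDir (s t u).digit u.1 v.1 with he
  set surv : ℕ → S → S → Bool := fun t u v => onDir (s t u).mark u.1 v.1 with hsurv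
  have hsel := select_tournament (F := F) (H := structureGraph S) (ℓ := ℓ + 3) (e := e)
    (surv := surv) (heard := heard) (by
      intro i hi u
      rw [hheard]
      simp only [decide_eq_true_eq]
      refine exists_congr fun v => ?_
      rw [exists_and_left]
      refine and_congr_right fun _ => ?_
      rw [hvoice i hi v]
      constructor
      · rintro ⟨d, h1, h2⟩
        obtain ⟨y, hy⟩ := hnbr i hi.le v d h1
        exact ⟨y, (onDir_eq hy).trans h1, (onDir_eq hy).trans h2⟩
      · rintro ⟨y, h1, h2⟩
        obtain ⟨d, hd, h1⟩ := onDir_eq_true.1 h1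
        exact ⟨d, h1, (onDir_eq hd).symm.trans h2⟩)
    (by
      intro i hi u v
      by_cases hd : ∃ d : Direction, v.1 = u.1 + d.vec
      · obtain ⟨d, hd⟩ := hd
        simp only [hsurv, he]
        rw [onDir_eq hd, onDir_eq hd, onDir_eq hd, hmarkstep i hi]
      · have : ∀ f, onDir f u.1 v.1 = false := by
          intro f
          rw [← Bool.not_eq_true, onDir_eq_true]
          exact fun ⟨d, h, _⟩ => hd ⟨d, h⟩
        simp only [hsurv, this, Bool.false_and])
    (by
      intro u v
      simp only [hsurv, onDir_eq_true]
      constructor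
      · rintro ⟨d, hd, h⟩
        obtain ⟨v', hv', hr⟩ := (hs.mark u d).1 h
        obtain rfl : v' = v := Subtype.ext (hv'.trans hd.symm)
        exact ⟨structureGraph_adj.2 ⟨d, hd⟩, hr⟩
      · rintro ⟨hadj, hr⟩
        obtain ⟨d, hd⟩ := structureGraph_adj.1 hadj
        exact ⟨d, hd, (hs.mark u d).2 ⟨v, hd, hr⟩⟩) (ℓ + 3) le_rfl
  set w : S → S → ℕ := fun u v => keyOf (fun j => e j u v) (ℓ + 3) with hw
  -- Both endpoints see the same digits, since they agree on the owner and the tie breaks depend on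
  -- the axis only.
  have hesymm : ∀ (u v : S) (d : Direction), v.1 = u.1 + d.vec → ∀ i < ℓ + 3, e i u v = e i v u := by
    intro u v d hd i hi
    have hd' := eq_add_vec_opp hd
    simp only [he]
    rw [onDir_eq hd, onDir_eq hd']
    rcases lt_trichotomy i (ℓ + 1) with h | rfl | h
    · cases i with
      | zero => rw [hs.digit, hs.digit]
      | succ i =>
        rw [hdigit i (by omega) u v d hd, hdigit i (by omega) v u d.opp hd', owns_opp]
        cases owns d <;> rfl
    · rw [(hA u).2, (hA v).2, axisA_opp]
    · obtain rfl : i = ℓ + 2 := by omega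
      rw [(hB u).2, (hB v).2, axisB_opp]
  refine ⟨ℓ + 4, by omega, w, ?_, ?_, ?_⟩
  · rintro u v ⟨hadj, _⟩
    obtain ⟨d, hd⟩ := structureGraph_adj.1 hadj
    exact keyOf_congr (hesymm u v d hd)
  · rintro u v u' v' ⟨hadj, _⟩ ⟨hadj', _⟩ heq
    obtain ⟨d, hd⟩ := structureGraph_adj.1 hadj
    obtain ⟨d', hd'⟩ := structureGraph_adj.1 hadj'
    have hdig := eq_of_keyOf_eq heq
    simp only [he] at hdig
    simp only [onDir_eq hd, onDir_eq hd'] at hdig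
    have h1 := hdig (ℓ + 1) (by omega)
    rw [(hA u).2, (hA u').2] at h1
    have h2 := hdig (ℓ + 2) (by omega)
    rw [(hB u).2, (hB u').2] at h2
    -- Edges of equal weight have the same owner, as the coins of different amoebots differ early
    -- enough to enter the digits. Equal axes then leave only one edge at this owner.
    have hown : (if owns d then u else v) = (if owns d' then u' else v') := by
      by_contra hne
      obtain ⟨i, hi, hxi⟩ := (hg 0 (by omega)).diff _ _ hne
      rw [zero_add] at hxi
      -- A coin tossed at time `i` is stored at `i + 1` and is a digit at `i + 2`.
      have h3 := hdig (i + 2) (by omega)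
      rw [hdigit (i + 1) (by omega) u v d hd, hdigit (i + 1) (by omega) u' v' d' hd',
        hcoin i (by omega), hcoin i (by omega), hcoin i (by omega), hcoin i (by omega)] at h3
      apply hxi
      revert h3
      cases owns d <;> cases owns d' <;> exact fun h => h
    rcases eq_or_eq_opp_of_axis h1 h2 with rfl | rfl
    · left
      cases ho : owns d' <;> rw [ho] at hown
      · have hvv : v = v' := hown
        subst hvv
        exact ⟨Subtype.ext ((eq_add_vec_opp hd).trans (eq_add_vec_opp hd').symm), rfl⟩
      · have huu : u = u' := hown
        subst huu
        exact ⟨rfl, Subtype.ext (hd.trans hd'.symm)⟩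
    · right
      have hd'' := eq_add_vec_opp hd'
      rw [Direction.opp_opp] at hd''
      rw [owns_opp] at hown
      cases ho : owns d <;> rw [ho] at hown
      · have hvu : v = u' := hown
        subst hvu
        exact ⟨Subtype.ext ((eq_add_vec_opp hd).trans hd'.symm), rfl⟩
      · have huv : u = v' := hown
        subst huv
        exact ⟨rfl, Subtype.ext (hd.trans hd''.symm)⟩
  · obtain ⟨hm, hmsg, h⟩ := hround3
    have hupd : ∀ u, s (ℓ + 4) u = { s (ℓ + 3) u with
        mode := .compare
        q := 0
        alive := true
        cand := true
        prev := false
        tree := fun d => (s (ℓ + 3) u).tree d || (s (ℓ + 3) u).mark d ||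
          ((s (ℓ + 3) u).nbr d && hm u d)
        mark := fun _ => false } := by
      intro u
      rw [h u]
      simp only [update, hM u]
    refine ⟨⟨?_, ?_⟩, ?_, ?_, ?_, ?_⟩
    · intro u d
      rw [hupd u]
      exact hbase3.nbr u d
    · intro u d
      rw [hupd u]
      simp only [Bool.or_eq_true, Bool.and_eq_true]
      rw [hbase3.tree, hbase3.nbr]
      have hheavy : ∀ (u v : S) (d : Direction), v.1 = u.1 + d.vec →
          ((s (ℓ + 3) u).mark d = true ↔ Heaviest (structureGraph S) F w u v) := by
        intro u v d hd
        rw [← hsel u v]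
        simp only [hsurv]
        rw [onDir_eq hd]
      constructor
      · rintro ((⟨v, hv, hadj⟩ | hmk) | ⟨⟨v, hv⟩, hmk⟩)
        · exact ⟨v, hv, mergeForest_adj.2 (Or.inl hadj)⟩
        · obtain ⟨v, hv⟩ := hnbr _ le_rfl u d hmk
          exact ⟨v, hv, mergeForest_adj.2 (Or.inr (Or.inl ((hheavy u v d hv).1 hmk)))⟩
        · rw [hmsg u v d hv] at hmk
          simp only [talk, hM v] at hmk
          exact ⟨v, hv, mergeForest_adj.2
            (Or.inr (Or.inr ((hheavy v u d.opp (eq_add_vec_opp hv)).1 hmk)))⟩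
      · rintro ⟨v, hv, hadj⟩
        rcases mergeForest_adj.1 hadj with hadj | hadj | hadj
        · exact Or.inl (Or.inl ⟨v, hv, hadj⟩)
        · exact Or.inl (Or.inr ((hheavy u v d hv).2 hadj))
        · refine Or.inr ⟨⟨v, hv⟩, ?_⟩
          rw [hmsg u v d hv]
          simp only [talk, hM v]
          exact (hheavy v u d.opp (eq_add_vec_opp hv)).2 hadj
    all_goals
      intro u
      rw [hupd u]
    · exact ⟨rfl, rfl, rfl⟩
    · exact fun _ => rfl

/-- With good coins, the machine computes a spanning tree. -/
lemma exists_spanningTree (hS : (structureGraph S).Connected) (ω : ℕ → S → Bool) {N : ℕ}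
    (hT : T + 3 ≤ (τ₀ + 2) * (P + 1))
    (hN : (Nat.log 2 S.card + 2) * (2 * ((τ₁ + 1) * (P + 1)) + 3) ≤ N)
    (hg : ∀ t < N, GoodAt P T τ₀ τ₁ ω t) :
    ∃ F : SimpleGraph S, IsSpanningTree S F ∧ ∀ u,
      (machine P).output ((machine P).run S (fun _ => ()) ω N u) = some (treeDirs F u) := by
  classical
  set s := (machine P).run S (fun _ => ()) ω with hs
  have hex : Exec s ω := exec_run hS ω
  set Λ := 2 * ((τ₁ + 1) * (P + 1)) + 3 with hΛ
  set L := Nat.log 2 S.card with hL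
  have hPΛ : P < (τ₁ + 1) * (P + 1) := by nlinarith [Nat.zero_le (τ₁ * (P + 1))]
  -- Either a tree has been completed, or `p` mergings have produced components of size at least `2
  -- ^ p`. The latter is impossible for `p = L + 1`, since `n < 2 ^ (L + 1)`. One further phase in
  -- `N` is slack for the windows of good coins.
  have key : ∀ p ≤ L + 1,
      (∃ t ≤ p * Λ, ∃ F, IsSpanningTree S F ∧ Base F (s t) ∧ ∀ u, (s t u).mode = .done) ∨
      (∃ t ≤ p * Λ, ∃ F, F ≤ structureGraph S ∧ F.IsAcyclic ∧ Start F (s t) ∧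
        ∀ u, 2 ^ p ≤ {v | F.Reachable u v}.ncard) := by
    intro p
    induction p with
    | zero =>
      intro _
      refine Or.inr ⟨0, by simp, ⊥, bot_le, SimpleGraph.isAcyclic_bot, ⟨⟨?_, ?_⟩, ?_, ?_, ?_, ?_⟩, ?_⟩
      · intro u d
        change decide (d ∈ neighborDirs S u) = true ↔ _
        rw [decide_eq_true_eq]
        exact ⟨fun h => ⟨⟨_, h⟩, rfl⟩, fun ⟨v, hv⟩ => by
          change u.1 + d.vec ∈ S
          rw [← hv]; exact v.2⟩
      · intro u d
        change false = true ↔ _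
        simp
      · exact fun u => ⟨rfl, rfl, rfl⟩
      · exact fun u => rfl
      · exact fun u => rfl
      · exact fun u d => rfl
      · intro u
        rw [pow_zero, Nat.one_le_iff_ne_zero]
        exact (Set.ncard_pos (Set.toFinite _)).2 ⟨u, SimpleGraph.Reachable.refl _⟩ |>.ne'
    | succ p ih =>
      intro hp
      have hpΛ : (p + 2) * Λ ≤ N := (Nat.mul_le_mul_right Λ (by omega)).trans hN
      have hsucc : (p + 1) * Λ = p * Λ + Λ := by ring
      have hsucc2 : (p + 2) * Λ = p * Λ + 2 * Λ := by ring
      rcases ih (by omega) with ⟨t, ht, h⟩ | ⟨t, ht, F, hF, hac, hst, hcard⟩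
      · exact Or.inl ⟨t, by omega, h⟩
      obtain ⟨ℓ, hℓ, hcase⟩ := compare_stage (hex.shift t) hF hst (T := T) (τ₀ := τ₀) (τ₁ := τ₁)
        (by
          intro t' ht'
          have := hg (t + t') (by omega)
          exact ⟨by simpa only [add_assoc] using this.diff, by simpa only [add_assoc] using this.low,
            by simpa only [add_assoc] using this.upp⟩) hT
      rcases hcase with ⟨hout, hsel⟩ | ⟨hout, hB, hdone⟩
      · obtain ⟨ℓ', hℓ', w, hw1, hw2, hst'⟩ := select_stage (hex.shift (t + ℓ)) hF hsel (T := T)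
          (τ₀ := τ₀) (τ₁ := τ₁) (by
            intro t' ht'
            have := hg (t + ℓ + t') (by omega)
            exact ⟨by simpa only [add_assoc] using this.diff,
              by simpa only [add_assoc] using this.low,
              by simpa only [add_assoc] using this.upp⟩) hT
        refine Or.inr ⟨t + ℓ + ℓ', by omega, _, mergeForest_le hF, mergeForest_isAcyclic hac hw1 hw2,
          hst', fun u => ?_⟩
        rw [pow_succ, mul_comm]
        exact two_mul_le_ncard_mergeForest hS hcard hout u
      · refine Or.inl ⟨t + ℓ, by omega, F, ⟨hF, ?_, hac⟩, hB, hdone⟩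
        refine { preconnected := fun u v => ?_, nonempty := hS.nonempty }
        by_contra huv
        obtain ⟨a, b, _, hab⟩ := exists_outgoing hS huv
        exact hout ⟨a, b, hab⟩
  rcases key (L + 1) le_rfl with ⟨t, ht, F, hF, hB, hdone⟩ | ⟨t, _, F, _, _, _, hcard⟩
  · refine ⟨F, hF, fun u => ?_⟩
    have hsucc2 : (L + 2) * Λ = (L + 1) * Λ + Λ := by ring
    refine (machine P).output_run_mono (t := t) (by omega) ?_
    change (match (s t u).mode with
      | .done => some {d | (s t u).tree d = true}
      | _ => none) = _
    rw [hdone u]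
    simp only [Option.some_inj]
    ext d
    exact hB.tree u d
  · obtain ⟨u⟩ := hS.nonempty
    have h1 := (hcard u).trans (Set.ncard_le_card _)
    have h2 : S.card < 2 ^ (L + 1) := Nat.lt_pow_succ_log_self (by norm_num) _
    simp only [Nat.card_eq_fintype_card, Fintype.card_coe] at h1
    omega

end Boruvka

/-! ### The probability of good coins -/

open MeasureTheory

section Coins

variable {S : Finset Node}

instance : IsProbabilityMeasure (coinMeasure S) := by unfold coinMeasure; infer_instance

/-- By independence, the measure of a box is a product; the default value of `Function.extend` lies
off the coordinates concerned. -/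
lemma coinMeasure_real_cylinder {ι : Type*} [Fintype ι] {e : ι → ℕ × S}
    (he : Function.Injective e) (f : ι → Bool) :
    (coinMeasure S).real {ω | ∀ i, ω (e i) = f i} = (1 / 2) ^ Fintype.card ι := by
  classical
  have hset : {ω : ℕ × S → Bool | ∀ i, ω (e i) = f i} =
      Set.pi ((Finset.univ.map ⟨e, he⟩ : Finset (ℕ × S)) : Set (ℕ × S))
        (fun p => {Function.extend e f (fun _ => true) p}) := by
    ext ω
    simp [Set.mem_pi, he.extend_apply]
  rw [hset, Measure.real, coinMeasure, Measure.infinitePi_pi _ (fun _ _ => measurableSet_singleton _)]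
  simp

/-- The probability that the coins at given positions form one of the patterns in `B`. -/
lemma coinMeasure_real_pattern_le {ι : Type*} [Fintype ι] {e : ι → ℕ × S}
    (he : Function.Injective e) (B : Finset (ι → Bool)) :
    (coinMeasure S).real {ω | (fun i => ω (e i)) ∈ B} ≤ B.card * (1 / 2) ^ Fintype.card ι := by
  have hset : {ω : ℕ × S → Bool | (fun i => ω (e i)) ∈ B} =
      ⋃ f ∈ B, {ω | ∀ i, ω (e i) = f i} := by
    ext ω
    simp only [Set.mem_ofPred_eq, Set.mem_iUnion, exists_prop]
    exact ⟨fun h => ⟨_, h, fun _ => rfl⟩, fun ⟨f, hf, h⟩ => (funext h : _ = f) ▸ hf⟩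
  rw [hset]
  refine (measureReal_biUnion_finset_le _ _).trans ?_
  simp only [coinMeasure_real_cylinder he]
  rw [Finset.sum_const, nsmul_eq_mul]

/-- Of the `4 ^ T` patterns of two rows, at most `2 ^ T` have equal rows. -/
lemma coinMeasure_real_same_le {a b : S} (hab : a ≠ b) (s T : ℕ) :
    (coinMeasure S).real {ω | ∀ i < T, ω (s + i, a) = ω (s + i, b)} ≤ (1 / 2) ^ T := by
  classical
  let e : Fin T × Bool → ℕ × S := fun p => (s + p.1.val, if p.2 then a else b)
  have he : Function.Injective e := by
    rintro ⟨i, c⟩ ⟨j, d⟩ h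
    simp only [e, Prod.mk.injEq, add_right_inj] at h
    refine Prod.ext (Fin.ext h.1) ?_
    have h2 := h.2
    cases c <;> cases d <;> simp_all
  let B : Finset (Fin T × Bool → Bool) :=
    Finset.univ.image fun (g : Fin T → Bool) p => g p.1
  have hB : (B.card : ℝ) ≤ 2 ^ T := by
    have : B.card ≤ 2 ^ T := Finset.card_image_le.trans (by simp)
    exact_mod_cast this
  have hsub : {ω : ℕ × S → Bool | ∀ i < T, ω (s + i, a) = ω (s + i, b)} ⊆
      {ω | (fun p => ω (e p)) ∈ B} := by
    intro ω hω
    refine Finset.mem_image.2 ⟨fun i => ω (s + i.val, a), Finset.mem_univ _, funext ?_⟩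
    rintro ⟨i, c⟩
    cases c
    · exact hω i.val i.2
    · rfl
  refine (measureReal_mono hsub).trans ((coinMeasure_real_pattern_le he B).trans ?_)
  rw [Fintype.card_prod, Fintype.card_fin, Fintype.card_bool, pow_mul, sq]
  calc (B.card : ℝ) * ((1 / 2) ^ T * (1 / 2) ^ T)
      ≤ 2 ^ T * ((1 / 2) ^ T * (1 / 2) ^ T) := by gcongr
    _ = (1 / 2) ^ T := by rw [← mul_assoc, ← mul_pow]; norm_num

lemma coinMeasure_real_run_le (u : S) (s p τ : ℕ) :
    (coinMeasure S).real {ω | ∀ i < τ, ω (s + i * (p + 1), u) = true} ≤ (1 / 2) ^ τ := by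
  have he : Function.Injective (fun i : Fin τ => (s + i.val * (p + 1), u)) := by
    intro i j h
    simpa [Fin.ext_iff] using h
  have := coinMeasure_real_cylinder he (fun _ => true)
  rw [Fintype.card_fin] at this
  rw [← this]
  exact measureReal_mono fun ω hω i => hω i.val i.2

/-- Each amoebot avoids one of `2 ^ τ` patterns, independently of the others. -/
lemma coinMeasure_real_no_run_le (s p τ : ℕ) :
    (coinMeasure S).real {ω | ∀ u, ∃ i < τ, ω (s + i * (p + 1), u) = false} ≤
      (1 - (1 / 2) ^ τ) ^ S.card := by
  classical
  let e : S × Fin τ → ℕ × S := fun q => (s + q.2.val * (p + 1), q.1)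
  have he : Function.Injective e := by
    rintro ⟨u, i⟩ ⟨v, j⟩ h
    simp only [e, Prod.mk.injEq] at h
    refine Prod.ext h.2 (Fin.ext ?_)
    simpa using h.1
  let B : Finset (S × Fin τ → Bool) :=
    (Fintype.piFinset fun _ : S => (Finset.univ.erase fun _ : Fin τ => true)).image
      fun g q => g q.1 q.2
  have hB : B.card ≤ (2 ^ τ - 1) ^ S.card := by
    refine Finset.card_image_le.trans ?_
    rw [Fintype.card_piFinset]
    simp [Finset.card_erase_of_mem]
  have hsub : {ω : ℕ × S → Bool | ∀ u, ∃ i < τ, ω (s + i * (p + 1), u) = false} ⊆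
      {ω | (fun q => ω (e q)) ∈ B} := by
    intro ω hω
    refine Finset.mem_image.2 ⟨fun u i => ω (s + i.val * (p + 1), u), ?_, rfl⟩
    rw [Fintype.mem_piFinset]
    intro u
    refine Finset.mem_erase.2 ⟨fun h => ?_, Finset.mem_univ _⟩
    obtain ⟨i, hi, hf⟩ := hω u
    have := congrFun h ⟨i, hi⟩
    simp only at this
    rw [hf] at this
    exact absurd this (by decide)
  refine (measureReal_mono hsub).trans ((coinMeasure_real_pattern_le he B).trans ?_)
  rw [Fintype.card_prod, Fintype.card_fin, Fintype.card_coe, mul_comm S.card, pow_mul]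
  calc (B.card : ℝ) * ((1 / 2) ^ τ) ^ S.card
      ≤ ((2 ^ τ - 1 : ℕ) : ℝ) ^ S.card * ((1 / 2) ^ τ) ^ S.card := by
        gcongr
        exact_mod_cast hB
    _ = (1 - (1 / 2) ^ τ) ^ S.card := by
        rw [← mul_pow, Nat.cast_sub Nat.one_le_two_pow]
        congr 1
        push_cast
        rw [sub_mul, ← mul_pow]
        norm_num

/-- The coins are good at all times before `N` up to the sum of the probabilities of the
exceptions. -/
lemma coinMeasure_real_not_good_le (P T τ₀ τ₁ N : ℕ) :
    (coinMeasure S).real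
      {ω | ¬ ∀ s < N, Boruvka.GoodAt P T τ₀ τ₁ (fun t u => ω (t, u)) s} ≤
      N * ((S.card : ℝ) ^ 2 * (1 / 2) ^ T + (1 - (1 / 2) ^ τ₀) ^ S.card +
        S.card * (1 / 2) ^ τ₁) := by
  classical
  let D : ℕ → S × S → Set (ℕ × S → Bool) := fun s q =>
    if q.1 = q.2 then ∅ else {ω | ∀ i < T, ω (s + i, q.1) = ω (s + i, q.2)}
  let R : ℕ → S → Set (ℕ × S → Bool) := fun s u =>
    {ω | ∀ i < τ₁, ω (s + i * (P + 1), u) = true}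
  let W : ℕ → Set (ℕ × S → Bool) := fun s =>
    {ω | ∀ u, ∃ i < τ₀, ω (s + i * (P + 1), u) = false}
  -- Stages begin at random times that depend on the coins, hence the union over all `s < N`.
  have hsub : {ω | ¬ ∀ s < N, Boruvka.GoodAt P T τ₀ τ₁ (fun t (u : S) => ω (t, u)) s} ⊆
      ⋃ s ∈ Finset.range N, ((⋃ q ∈ (Finset.univ : Finset (S × S)), D s q) ∪ W s ∪
        ⋃ u ∈ (Finset.univ : Finset S), R s u) := by
    intro ω hω
    simp only [Set.mem_ofPred_eq, not_forall] at hω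
    obtain ⟨s, hs, hω⟩ := hω
    refine Set.mem_biUnion (Finset.mem_coe.2 (Finset.mem_range.2 hs)) ?_
    by_contra hn
    simp only [Set.mem_union, not_or] at hn
    obtain ⟨⟨h1, h2⟩, h3⟩ := hn
    refine hω ⟨?_, ?_, ?_⟩
    · intro a b hab
      by_contra! hc
      refine h1 (Set.mem_biUnion (x := (a, b)) (Finset.mem_coe.2 (Finset.mem_univ _)) ?_)
      simp only [D, if_neg hab]
      exact hc
    · by_contra! hc
      refine h2 fun u => ?_
      obtain ⟨i, hi, h⟩ := hc u
      exact ⟨i, hi, by simpa using h⟩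
    · intro u
      by_contra! hc
      refine h3 (Set.mem_biUnion (x := u) (Finset.mem_coe.2 (Finset.mem_univ _)) ?_)
      intro i hi
      simpa using hc i hi
  refine (measureReal_mono hsub (measure_ne_top _ _)).trans ((measureReal_biUnion_finset_le _ _).trans ?_)
  have hterm : ∀ s ∈ Finset.range N,
      (coinMeasure S).real ((⋃ q ∈ (Finset.univ : Finset (S × S)), D s q) ∪ W s ∪
        ⋃ u ∈ (Finset.univ : Finset S), R s u) ≤
      (S.card : ℝ) ^ 2 * (1 / 2) ^ T + (1 - (1 / 2) ^ τ₀) ^ S.card +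
        S.card * (1 / 2) ^ τ₁ := by
    intro s _
    refine (measureReal_union_le _ _).trans (add_le_add ((measureReal_union_le _ _).trans
      (add_le_add ?_ (coinMeasure_real_no_run_le s P τ₀))) ?_)
    · refine (measureReal_biUnion_finset_le _ _).trans
        ((Finset.sum_le_card_nsmul _ _ ((1 / 2) ^ T) ?_).trans (le_of_eq ?_))
      · rintro ⟨a, b⟩ _
        by_cases hab : a = b
        · simp only [D, if_pos hab, measureReal_empty]
          positivity
        · simp only [D, if_neg hab]
          exact coinMeasure_real_same_le hab s T
      · simp [sq]
    · refine (measureReal_biUnion_finset_le _ _).trans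
        ((Finset.sum_le_card_nsmul _ _ ((1 / 2) ^ τ₁) ?_).trans (le_of_eq ?_))
      · exact fun u _ => coinMeasure_real_run_le u s P τ₁
      · simp
  refine (Finset.sum_le_card_nsmul _ _ _ hterm).trans (le_of_eq ?_)
  rw [Finset.card_range, nsmul_eq_mul]

end Coins

/-! ### Choice of the parameters -/

/-- The second bound makes coincidences of coins and overlong runs unlikely, `c + 4` being the
number of factors of order `2 ^ (L + 1)` in `(L + 1) ^ 2 * n ^ 2 * n ^ c`. The first one is for the
absence of long runs. -/
lemma exists_parameter (c : ℕ) : ∃ A : ℕ, 32 * (c + 11) ≤ A ∧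
    88 * A ^ 3 * 2 ^ (c + 4) ≤ 2 ^ A := by
  have h := tendsto_pow_const_div_const_pow_of_one_lt 3 (show (1 : ℝ) < 2 by norm_num)
  have hpos : (0 : ℝ) < 1 / (88 * 2 ^ (c + 4)) := by positivity
  obtain ⟨A, h1, h2⟩ := ((h.eventually_lt_const hpos).and
    (Filter.eventually_ge_atTop (32 * (c + 11)))).exists
  refine ⟨A, h2, ?_⟩
  rw [div_lt_div_iff₀ (by positivity) (by positivity), one_mul] at h1
  have : (88 * A ^ 3 * 2 ^ (c + 4) : ℝ) ≤ 2 ^ A := by nlinarith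
  exact_mod_cast this

/-- Bound each of two factors `2 ^ (k / 2)` from below by `k / 2 + 1`: a quadratic beats the linear
left side. -/
lemma mul_le_two_pow {m k : ℕ} (h : 16 * m ≤ k) : m * (2 * k + 2) ≤ 2 ^ k := by
  have h1 : k / 2 + 1 ≤ 2 ^ (k / 2) := Nat.lt_two_pow_self
  have h2 : 2 ^ (k / 2) * 2 ^ (k / 2) ≤ 2 ^ k := by
    rw [← pow_add]
    exact Nat.pow_le_pow_right (by norm_num) (by omega)
  have h3 : k + 1 ≤ 2 * (k / 2 + 1) := by omega
  have h4 : 8 * m ≤ k / 2 + 1 := by omega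
  have h5 : (k / 2 + 1) * (k / 2 + 1) ≤ 2 ^ (k / 2) * 2 ^ (k / 2) := Nat.mul_le_mul h1 h1
  nlinarith

/-- The probability of failure for `n` amoebots with `L = log n`. -/
lemma failure_le {c A n L : ℕ} (hA : 32 * (c + 11) ≤ A) (hA' : 88 * A ^ 3 * 2 ^ (c + 4) ≤ 2 ^ A)
    (hn : 2 ^ L ≤ n) (hn' : n < 2 ^ (L + 1)) :
    ((22 * A ^ 3 * (L + 1) ^ 2 : ℕ) : ℝ) * ((n : ℝ) ^ 2 * (1 / 2) ^ (A * (L + 1)) +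
      (1 - (1 / 2) ^ (L / A)) ^ n + n * (1 / 2) ^ (A * (L + 1))) ≤ 1 / (n : ℝ) ^ c := by
  have hn0 : 1 ≤ n := le_trans Nat.one_le_two_pow hn
  have hnpos : (0 : ℝ) < n := by exact_mod_cast hn0
  have hnle : (n : ℝ) ≤ 2 ^ (L + 1) := by exact_mod_cast hn'.le
  have hM : L + 1 ≤ 2 ^ (L + 1) := Nat.lt_two_pow_self.le
  rw [le_div_iff₀ (by positivity)]
  have hfirst : ((22 * A ^ 3 * (L + 1) ^ 2 : ℕ) : ℝ) *
      ((n : ℝ) ^ 2 * (1 / 2) ^ (A * (L + 1)) + n * (1 / 2) ^ (A * (L + 1))) * (n : ℝ) ^ c ≤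
      1 / 2 := by
    have h1 : 88 * A ^ 3 * (L + 1) ^ 2 * n ^ 2 * n ^ c ≤ 2 ^ (A * (L + 1)) := by
      -- Split off the exponents `2 + 2 + c` of the powers of `2 ^ (L + 1)`; the remaining `2 ^ B`
      -- absorbs the constant.
      obtain ⟨B, hB⟩ : ∃ B, A = B + (c + 4) := ⟨A - (c + 4), by omega⟩
      have h2 : 88 * A ^ 3 ≤ 2 ^ B := by
        have : 88 * A ^ 3 * 2 ^ (c + 4) ≤ 2 ^ B * 2 ^ (c + 4) := by
          rw [← pow_add, ← hB]; exact hA'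
        exact Nat.le_of_mul_le_mul_right this (by positivity)
      calc 88 * A ^ 3 * (L + 1) ^ 2 * n ^ 2 * n ^ c
          ≤ 2 ^ B * (2 ^ (L + 1)) ^ 2 * (2 ^ (L + 1)) ^ 2 * (2 ^ (L + 1)) ^ c := by gcongr
        _ ≤ (2 ^ B) ^ (L + 1) * (2 ^ (L + 1)) ^ 2 * (2 ^ (L + 1)) ^ 2 * (2 ^ (L + 1)) ^ c := by
            have h := Nat.le_self_pow (Nat.succ_ne_zero L) (2 ^ B)
            exact Nat.mul_le_mul_right _ (Nat.mul_le_mul_right _ (Nat.mul_le_mul_right _ h))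
        _ = 2 ^ (A * (L + 1)) := by
            rw [hB, ← pow_mul, ← pow_mul, ← pow_mul, ← pow_add, ← pow_add, ← pow_add]
            congr 1
            ring
    have h1' : (88 * A ^ 3 * (L + 1) ^ 2 * n ^ 2 * n ^ c : ℝ) ≤ 2 ^ (A * (L + 1)) := by
      exact_mod_cast h1
    have hnn : (n : ℝ) ≤ n ^ 2 := by
      have : (1 : ℝ) ≤ n := by exact_mod_cast hn0
      nlinarith
    calc _ ≤ ((22 * A ^ 3 * (L + 1) ^ 2 : ℕ) : ℝ) *
          ((n : ℝ) ^ 2 * (1 / 2) ^ (A * (L + 1)) + n ^ 2 * (1 / 2) ^ (A * (L + 1))) *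
          (n : ℝ) ^ c := by gcongr
      _ = (88 * A ^ 3 * (L + 1) ^ 2 * n ^ 2 * n ^ c : ℝ) * (1 / 2) ^ (A * (L + 1)) * (1 / 2) := by
          push_cast; ring
      _ ≤ 2 ^ (A * (L + 1)) * (1 / 2) ^ (A * (L + 1)) * (1 / 2) := by gcongr
      _ = 1 / 2 := by rw [← mul_pow]; norm_num
  have hsecond : ((22 * A ^ 3 * (L + 1) ^ 2 : ℕ) : ℝ) * (1 - (1 / 2) ^ (L / A)) ^ n *
      (n : ℝ) ^ c ≤ 1 / 2 := by
    -- For `L < A` the required run is empty, so it cannot be missing.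
    rcases Nat.lt_or_ge L A with hLA | hLA
    · rw [Nat.div_eq_of_lt hLA, pow_zero, sub_self, zero_pow (by omega)]
      norm_num
    · set k := L / 2 with hk
      -- The exponent `c + 11` is `6 + 3 + 2 + c`, from `44 ≤ 2 ^ 6`, `A ≤ L` and the other two
      -- factors. As `L ≥ 32 * (c + 11)`, `mul_le_two_pow` applies to `k = L / 2`.
      have h1 : 44 * A ^ 3 * (L + 1) ^ 2 * n ^ c ≤ 2 ^ 2 ^ k := by
        calc 44 * A ^ 3 * (L + 1) ^ 2 * n ^ c
            ≤ (2 ^ (L + 1)) ^ 6 * (2 ^ (L + 1)) ^ 3 * (2 ^ (L + 1)) ^ 2 * (2 ^ (L + 1)) ^ c := by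
              gcongr
              · calc 44 ≤ 2 ^ 6 := by norm_num
                  _ ≤ (2 ^ (L + 1)) ^ 6 := by gcongr; exact Nat.le_self_pow (by omega) _
              · exact le_trans (by omega) hM
          _ = 2 ^ ((c + 11) * (L + 1)) := by
              rw [← pow_mul, ← pow_mul, ← pow_mul, ← pow_mul, ← pow_add, ← pow_add, ← pow_add]
              congr 1
              ring
          _ ≤ 2 ^ 2 ^ k := by
              refine Nat.pow_le_pow_right (by norm_num) ?_
              refine le_trans (Nat.mul_le_mul_left _ (by omega)) (mul_le_two_pow ?_)
              omega
      have h1' : (44 * A ^ 3 * (L + 1) ^ 2 * n ^ c : ℝ) ≤ 2 ^ 2 ^ k := by exact_mod_cast h1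
      have h2 : (1 - (1 / 2 : ℝ) ^ (L / A)) ^ n ≤ (1 / 2) ^ 2 ^ k := by
        have h3 : (0 : ℝ) ≤ 1 - (1 / 2) ^ (L / A) :=
          sub_nonneg.2 (pow_le_one₀ (by norm_num) (by norm_num))
        have h4 : 1 - (1 / 2 : ℝ) ^ (L / A) ≤ Real.exp (-(1 / 2) ^ (L / A)) := by
          have := Real.add_one_le_exp (-(1 / 2 : ℝ) ^ (L / A))
          linarith
        have h5 : ((2 ^ k : ℕ) : ℝ) ≤ n * (1 / 2) ^ (L / A) := by
          have h6 : L / A ≤ L / 2 := Nat.div_le_div_left (by omega) (by norm_num)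
          have h7 : 2 ^ k * 2 ^ (L / A) ≤ n := by
            rw [← pow_add]
            exact le_trans (Nat.pow_le_pow_right (by norm_num) (by omega)) hn
          have h7' : (2 ^ k * 2 ^ (L / A) : ℝ) ≤ n := by exact_mod_cast h7
          push_cast
          rw [one_div, inv_pow, ← div_eq_mul_inv, le_div_iff₀ (by positivity)]
          exact h7'
        calc (1 - (1 / 2 : ℝ) ^ (L / A)) ^ n ≤ Real.exp (-(1 / 2) ^ (L / A)) ^ n := by gcongr
          _ = Real.exp (-(n * (1 / 2) ^ (L / A))) := by
              rw [← Real.exp_nat_mul]; congr 1; ring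
          _ ≤ Real.exp (-((2 ^ k : ℕ) : ℝ)) := by gcongr
          _ = Real.exp (-1) ^ 2 ^ k := by rw [← Real.exp_nat_mul]; congr 1; ring
          _ ≤ (1 / 2) ^ 2 ^ k := by
              gcongr
              rw [Real.exp_neg, one_div]
              gcongr
              have := Real.add_one_le_exp 1
              linarith
      calc _ ≤ ((22 * A ^ 3 * (L + 1) ^ 2 : ℕ) : ℝ) * (1 / 2) ^ 2 ^ k * (n : ℝ) ^ c := by gcongr
        _ = (44 * A ^ 3 * (L + 1) ^ 2 * n ^ c : ℝ) * (1 / 2) ^ 2 ^ k * (1 / 2) := by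
            push_cast; ring
        _ ≤ 2 ^ 2 ^ k * (1 / 2) ^ 2 ^ k * (1 / 2) := by gcongr
        _ = 1 / 2 := by rw [← mul_pow]; norm_num
  linarith [hfirst, hsecond]

/-- A spanning tree is computed from scratch in a polylogarithmic number of rounds, with high
probability. -/
theorem exists_randomized_algorithm : ∃ k : ℕ, ∀ c : ℕ,
    ∃ (A : Algorithm k Bool Unit (Set Direction)) (C : ℕ),
      ∀ S : Finset Node, (structureGraph S).Connected →
        1 - 1 / (S.card : ℝ) ^ c ≤
          (coinMeasure S).real
            {ω | ∃ σ : Skeleton S, IsSpanningTree S σ.tree ∧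
              A.ComputesTree (fun _ => ()) (fun t u => ω (t, u))
                (C * (Nat.log 2 S.card + 1) ^ 2) σ.tree} := by
  refine ⟨Fintype.card Boruvka.Label, fun c => ?_⟩
  obtain ⟨A, hA, hA'⟩ := exists_parameter c
  -- `c` enters only through the period of the clock, i.e. the number of states, so the links do not
  -- depend on it. The period `A ^ 2 + 1` turns the guaranteed `L / A` periods into at least `A * (L
  -- + 1)` rounds. There are `L + 2 ≤ 2 * (L + 1)` phases of at most `11 * A ^ 3 * (L + 1)` rounds
  -- each, whence `22 * A ^ 3`.
  refine ⟨(Boruvka.machine (A ^ 2)).toAlgorithm (Fintype.equivFin _), 22 * A ^ 3, ?_⟩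
  intro S hS
  obtain ⟨⟨v, hv⟩⟩ := hS.nonempty
  have hcard : S.card ≠ 0 := Finset.card_ne_zero_of_mem hv
  set L := Nat.log 2 S.card with hL
  set N := 22 * A ^ 3 * (L + 1) ^ 2 with hN
  set good : Set (ℕ × S → Bool) := {ω | ∀ s < N,
    Boruvka.GoodAt (A ^ 2) (A * (L + 1)) (L / A) (A * (L + 1)) (fun t u => ω (t, u)) s} with hgood
  have hbad : (coinMeasure S).real goodᶜ ≤ 1 / (S.card : ℝ) ^ c := by
    refine (coinMeasure_real_not_good_le (S := S) (A ^ 2) (A * (L + 1)) (L / A) (A * (L + 1))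
      N).trans (failure_le hA hA' (Nat.pow_log_le_self 2 hcard)
        (Nat.lt_pow_succ_log_self (by norm_num) _))
  have hone : 1 ≤ (coinMeasure S).real good + (coinMeasure S).real goodᶜ := by
    have := measureReal_union_le (μ := coinMeasure S) good goodᶜ
    rwa [Set.union_compl_self, probReal_univ] at this
  have hA1 : 1 ≤ A := by omega
  refine le_trans (by linarith) (measureReal_mono (s₁ := good) fun ω hω => ?_)
  obtain ⟨F, hF, hout⟩ := Boruvka.exists_spanningTree (P := A ^ 2) (T := A * (L + 1))
    (τ₀ := L / A) (τ₁ := A * (L + 1)) hS (fun t u => ω (t, u)) (N := N) (by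
      have h1 := Nat.lt_div_mul_add (a := L) hA1
      have h2 : L + 1 ≤ (L / A + 1) * A := by linarith
      have h3 : A * (L + 1) ≤ A * ((L / A + 1) * A) := Nat.mul_le_mul_left _ h2
      have h4 : 1 ≤ A ^ 2 := Nat.one_le_pow _ _ hA1
      nlinarith [Nat.zero_le (L / A)]) (by
      have h4 : A ≤ A ^ 3 := Nat.le_self_pow (by norm_num) A
      have h5 : A ^ 2 ≤ A ^ 3 := Nat.pow_le_pow_right hA1 (by norm_num)
      have h6 : 1 ≤ A ^ 3 := Nat.one_le_pow _ _ hA1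
      have h7 : 2 * ((A * (L + 1) + 1) * (A ^ 2 + 1)) + 3 ≤ 11 * A ^ 3 * (L + 1) := by
        have : 2 * ((A * (L + 1) + 1) * (A ^ 2 + 1)) + 3 =
          2 * A ^ 3 * (L + 1) + 2 * A * (L + 1) + 2 * A ^ 2 + 5 := by ring
        rw [this]
        nlinarith [Nat.mul_le_mul_right (L + 1) h4, Nat.mul_le_mul_right (L + 1) h5,
          Nat.mul_le_mul_right (L + 1) h6, Nat.zero_le (A ^ 3 * L)]
      calc (L + 2) * (2 * ((A * (L + 1) + 1) * (A ^ 2 + 1)) + 3)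
          ≤ (2 * (L + 1)) * (11 * A ^ 3 * (L + 1)) := Nat.mul_le_mul (by omega) h7
        _ = N := by rw [hN]; ring) hω
  obtain ⟨σ, rfl⟩ := exists_skeleton_tree_eq hF
  refine ⟨σ, hF, fun u => ?_⟩
  rw [Machine.run_toAlgorithm]
  exact hout u

end Amoebot

theorem mainTheorem4 :
    -- Given a skeleton (with a constant number of occurrences of each amoebot), deterministically.
    (∀ K : ℕ, ∃ (k : ℕ)
      (A : Amoebot.Algorithm k Unit (Fin K → Option (Amoebot.Occurrence K))
        (Set Amoebot.Direction)) (C : ℕ),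
      ∀ S : Finset Amoebot.Node, (Amoebot.structureGraph S).Connected →
      ∀ (σ : Amoebot.Skeleton S) (slot : Fin σ.len → Fin K),
        Function.Injective (fun i => (σ.node i, slot i)) →
        Amoebot.IsSpanningTree S σ.tree ∧
        A.ComputesTree (σ.view slot) (fun _ _ => ()) (C * (Nat.log 2 S.card + 1)) σ.tree) ∧
    -- Altogether, without any input, with high probability.
    (∃ k : ℕ, ∀ c : ℕ, ∃ (A : Amoebot.Algorithm k Bool Unit (Set Amoebot.Direction)) (C : ℕ),
      ∀ S : Finset Amoebot.Node, (Amoebot.structureGraph S).Connected →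
        1 - 1 / (S.card : ℝ) ^ c ≤
          (Amoebot.coinMeasure S).real
            {ω | ∃ σ : Amoebot.Skeleton S, Amoebot.IsSpanningTree S σ.tree ∧
              A.ComputesTree (fun _ => ()) (fun t u => ω (t, u))
                (C * (Nat.log 2 S.card + 1) ^ 2) σ.tree}) :=
  ⟨Amoebot.exists_algorithm_of_skeleton, Amoebot.exists_randomized_algorithm⟩
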